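/- Let $G$ be a countable group and $d\in\mathbb N$. A $G^d$-space $\mathbf X=(X,\mu,T_1,\dots,T_d)$ is a standard Borel probability space with $d$ commuting $\mu$-preserving actions $T_1,\dots,T_d$ of $G$ (equivalently, one action of the group $G^d$). An extension $\xi:\mathbf Y\to\mathbf X$ of $G^d$-spaces is a measurable, measure-preserving map intertwining the actions almost everywhere. Write $[i;j)=\{i,\dots,j-1\}$ and $(i;j]=\{i+1,\dots,j\}$. For $e=\{i_1<\dots<i_\ell\}\subseteq[d]=\{1,\dots,d\}$ with $\ell\ge 1$ let $L_e\le G^d$ be the subgroup of all tuples $(g_1,\dots,g_d)$ that are constant on each interval $(i_s;i_{s+1}]$ and satisfy $g_k=1$ for $k\notin(i_1;i_\ell]$, and let $\Phi^e_{\mathbf X}$ be the $\sigma$-algebra of $L_e$-almost-invariant measurable sets, i.e. of those $A$ with $\mu(hA\,\triangle\,A)=0$ for all $h\in L_e$. All $\sigma$-subalgebras are understood modulo $\mu$-null sets. For $\sigma$-subalgebras $\Phi\subseteq\Sigma_1\cap\Sigma_2$, call $\Sigma_1$ and $\Sigma_2$ relatively independent over $\Phi$ if $\int fg\,d\mu=\int\mathsf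 E(f\mid\Phi)\,\mathsf E(g\mid\Phi)\,d\mu$ for all bounded real-valued $f,g$ that are $\Sigma_1$- and $\Sigma_2$-measurable respectively. For a functorial $\sigma$-subalgebra $\mathsf F$ of $G^d$-spaces (an assignment $\mathbf Y\mapsto\Sigma^{\mathsf F}_{\mathbf Y}$ of a $\sigma$-subalgebra of $\Sigma_{\mathbf Y}$ to every $G^d$-space, with $\xi^{-1}(\Sigma^{\mathsf F}_{\mathbf X})\subseteq\Sigma^{\mathsf F}_{\mathbf Y}$ for every extension $\xi:\mathbf Y\to\mathbf X$), such as the finite joins of the $\Phi^e$, the space $\mathbf X$ is $\mathsf F$-sated if for every extension $\xi:\mathbf Y\to\mathbf X$ the $\sigma$-algebras $\xi^{-1}(\Sigma_{\mathbf X})$ and $\Sigma^{\mathsf F}_{\mathbf Y}$ are relatively independent over $\xi^{-1}(\Sigma^{\mathsf F}_{\mathbf X})$. It is fully sated if it is sated for $\bigvee_{s=1}^r\Phi^{e_s}$ for all finite families of sets $e_1,\dots,e_r\subseteq[d]$ with $|e_s|\ge2$. Let $\mathbf X$ be a $G^d$-space and let $e_1,\dots,e_r\subseteq[d]$ with $|e_s|\ge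 2$ for all $s$. (A) Let $\{i<j\}\subseteq[d]$. (1) If $e_s\cap[i;j)=\{i\}$ for every $s\le r$ and $\mathbf X$ is sated for $\bigvee_{s=1}^r\Phi^{e_s\cup\{j\}}$, then $\Phi^{\{i,j\}}_{\mathbf X}$ and $\bigvee_{s=1}^r\Phi^{e_s}_{\mathbf X}$ are relatively independent over $\bigvee_{s=1}^r\Phi^{e_s\cup\{j\}}_{\mathbf X}$. (2) If $e_s\cap(i;j]=\{j\}$ for every $s\le r$ and $\mathbf X$ is sated for $\bigvee_{s=1}^r\Phi^{e_s\cup\{i\}}$, then $\Phi^{\{i,j\}}_{\mathbf X}$ and $\bigvee_{s=1}^r\Phi^{e_s}_{\mathbf X}$ are relatively independent over $\bigvee_{s=1}^r\Phi^{e_s\cup\{i\}}_{\mathbf X}$. (B) Suppose that $\mathbf X$ is fully sated, and let $e_0\subseteq[d]$ with $|e_0|\ge2$ and $\bigcap_{0\le s\le r}e_s\ne\emptyset$. Put $\Psi=\bigvee_{s=1}^r\Phi^{e_0\cup e_s}_{\mathbf X}$. If $g$ is bounded, real-valued and $\Phi^{e_0}_{\mathbf X}$-measurable and $f_s$ is bounded,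 real-valued and $\Phi^{e_s}_{\mathbf X}$-measurable for $1\le s\le r$, then $$\int_X g\,f_1\cdots f_r\,d\mu=\int_X\mathsf E_\mu(g\mid\Psi)\,f_1\cdots f_r\,d\mu .$$ Moreover, for every integrable, real-valued, $\Phi^{e_0}_{\mathbf X}$-measurable $g$, $$\mathsf E_\mu\Big(g\,\Big|\,\bigvee_{s=1}^r\Phi^{e_s}_{\mathbf X}\Big)=\mathsf E_\mu(g\mid\Psi)\quad\mu\text{-almost everywhere.}$$ -/

import Mathlib

open MeasureTheory

universe u v

/-- A `Γ`-space: a standard Borel probability space with an action of the group `Γ` by measurable,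
measure-preserving transformations. A `G^d`-space, that is, a space with `d` commuting
measure-preserving actions `T_1, …, T_d` of `G`, is a `GSpace (Fin d → G)`: the `i`-th action is
`T_i^g x = Pi.mulSingle i g • x`. -/
structure GSpace (Γ : Type v) [Group Γ] where
  carrier : Type u
  [measurableSpace : MeasurableSpace carrier]
  [standardBorel : StandardBorelSpace carrier]
  [action : MulAction Γ carrier]
  [measurableAction : MeasurableConstSMul Γ carrier]
  μ : Measure carrier
  [isProbability : IsProbabilityMeasure μ]
  [invariant : SMulInvariantMeasure Γ carrier μ]

namespace GSpace

attribute [instance] measurableSpace standardBorel action measurableAction isProbability invariant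

/-- `π` is a factor map from `X` onto `Y`, that is, `π : X → Y` is a `Γ`-extension of `Y`. -/
structure IsExtension {Γ : Type v} [Group Γ] (X Y : GSpace.{u} Γ)
    (π : X.carrier → Y.carrier) : Prop where
  measurePreserving : MeasurePreserving π X.μ Y.μ
  equivariant : ∀ g : Γ, ∀ᵐ x ∂X.μ, π (g • x) = g • π x

/-- The `σ`-algebra of `H`-almost-invariant sets. All `σ`-subalgebras here consist of Borel sets
and matter only up to null sets: measurability of functions with respect to them is always
understood almost everywhere, so they can be replaced by their completions throughout.
(As `h` ranges over a subgroup, images may be replaced by preimages.) -/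
@[reducible]
def invariantSigma {Γ : Type v} [Group Γ] (X : GSpace.{u} Γ) (H : Subgroup Γ) :
    MeasurableSpace X.carrier where
  MeasurableSet' A := MeasurableSet A ∧ ∀ h ∈ H, (fun x => h • x) ⁻¹' A =ᵐ[X.μ] A
  measurableSet_empty := ⟨MeasurableSet.empty, fun _ _ => by simp⟩
  measurableSet_compl A hA := ⟨hA.1.compl, fun h hh => by
    simpa using (hA.2 h hh).compl⟩
  measurableSet_iUnion f hf := ⟨MeasurableSet.iUnion fun n => (hf n).1, fun h hh => by
    rw [Set.preimage_iUnion]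
    exact Filter.EventuallyEq.countable_iUnion fun n => (hf n).2 h hh⟩

end GSpace

/-- A functorial `σ`-subalgebra of `Γ`-spaces. -/
structure FunctorialSigma (Γ : Type v) [Group Γ] where
  toFun : ∀ X : GSpace.{u} Γ, MeasurableSpace X.carrier
  le : ∀ X : GSpace.{u} Γ, toFun X ≤ X.measurableSpace
  functorial : ∀ (X Y : GSpace.{u} Γ) (π : X.carrier → Y.carrier),
    GSpace.IsExtension X Y π → (toFun Y).comap π ≤ toFun X

namespace FunctorialSigma

/-- The functorial `σ`-subalgebra of `H`-almost-invariant sets, for a subgroup `H`. -/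
def ofSubgroup {Γ : Type v} [Group Γ] (H : Subgroup Γ) : FunctorialSigma.{u} Γ where
  toFun X := X.invariantSigma H
  le _ _ hA := hA.1
  functorial X Y π hπ := by
    rintro _ ⟨A, hA, rfl⟩
    refine ⟨hπ.measurePreserving.measurable hA.1, fun h hh => ?_⟩
    have h1 : (fun x => h • x) ⁻¹' (π ⁻¹' A) =ᵐ[X.μ] π ⁻¹' ((fun y => h • y) ⁻¹' A) := by
      filter_upwards [hπ.equivariant h] with x hx
      change (π (h • x) ∈ A) = (h • π x ∈ A)
      rw [hx]
    exact h1.trans (hπ.measurePreserving.quasiMeasurePreserving.preimage_ae_eq (hA.2 h hh))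

/-- The join (generated `σ`-algebra) of a family of functorial `σ`-subalgebras. -/
def join {Γ : Type v} [Group Γ] {ι : Type} (F : ι → FunctorialSigma.{u} Γ) :
    FunctorialSigma.{u} Γ where
  toFun X := ⨆ s, (F s).toFun X
  le X := iSup_le fun s => (F s).le X
  functorial X Y π hπ := by
    rw [MeasurableSpace.comap_iSup]
    exact iSup_mono fun s => (F s).functorial X Y π hπ

end FunctorialSigma

/-- The `σ`-subalgebras `m₁` and `m₂` are relatively independent over their common
`σ`-subalgebra `m` under `μ`. -/
structure RelIndep {Ω : Type u} [mΩ : MeasurableSpace Ω] (μ : Measure Ω)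
    (m₁ m₂ m : MeasurableSpace Ω) : Prop where
  le_left : m₁ ≤ mΩ
  le_right : m₂ ≤ mΩ
  base_le_left : m ≤ m₁
  base_le_right : m ≤ m₂
  integral_mul : ∀ f g : Ω → ℝ,
    AEStronglyMeasurable[m₁] f μ → MemLp f ⊤ μ →
    AEStronglyMeasurable[m₂] g μ → MemLp g ⊤ μ →
      ∫ x, f x * g x ∂μ = ∫ x, (μ[f | m]) x * (μ[g | m]) x ∂μ

/-- `X` is `F`-sated: for every extension `ξ : Y → X`, the `σ`-subalgebras `ξ⁻¹(Σ_X)` and `F_Y`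
are relatively independent over `ξ⁻¹(F_X)`. -/
def IsSated {Γ : Type v} [Group Γ] (F : FunctorialSigma.{u} Γ) (X : GSpace.{u} Γ) : Prop :=
  ∀ (Y : GSpace.{u} Γ) (ξ : Y.carrier → X.carrier), GSpace.IsExtension Y X ξ →
    RelIndep Y.μ (X.measurableSpace.comap ξ) (F.toFun Y) ((F.toFun X).comap ξ)

/-- For `e = {i_1 < … < i_ℓ}`, the subgroup `L_e` of `G^d`: the tuples that are constant on each
interval `(i_s; i_{s+1}]` and trivial outside `(i_1; i_ℓ]`. -/
def subgroupL (G : Type v) [Group G] {d : ℕ} (e : Finset (Fin d)) : Subgroup (Fin d → G) where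
  carrier := {g |
    (∀ a ∈ e, ∀ b ∈ e, a < b → (∀ c ∈ e, ¬ (a < c ∧ c < b)) →
      ∀ k ∈ Finset.Ioc a b, ∀ l ∈ Finset.Ioc a b, g k = g l) ∧
    (∀ k, (¬ ∃ a ∈ e, ∃ b ∈ e, k ∈ Finset.Ioc a b) → g k = 1)}
  one_mem' := ⟨fun _ _ _ _ _ _ _ _ _ _ => rfl, fun _ _ => rfl⟩
  mul_mem' {x y} hx hy := by
    refine ⟨fun a ha b hb hab hc k hk l hl => ?_, fun k hk => ?_⟩
    · simp only [Pi.mul_apply]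
      rw [hx.1 a ha b hb hab hc k hk l hl, hy.1 a ha b hb hab hc k hk l hl]
    · simp only [Pi.mul_apply]
      rw [hx.2 k hk, hy.2 k hk, one_mul]
  inv_mem' {x} hx := by
    refine ⟨fun a ha b hb hab hc k hk l hl => ?_, fun k hk => ?_⟩
    · simp only [Pi.inv_apply]
      rw [hx.1 a ha b hb hab hc k hk l hl]
    · simp only [Pi.inv_apply]
      rw [hx.2 k hk, inv_one]

/-- The functorial `σ`-subalgebra `Φ^e` of `G^d`-spaces: the `L_e`-almost-invariant sets. -/
def Phi (G : Type v) [Group G] {d : ℕ} (e : Finset (Fin d)) :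
    FunctorialSigma.{u} (Fin d → G) :=
  FunctorialSigma.ofSubgroup (subgroupL G e)

/-- The functorial `σ`-subalgebra `⋁_s Φ^{e_s}` of `G^d`-spaces. -/
def joinPhi (G : Type v) [Group G] {d r : ℕ} (e : Fin r → Finset (Fin d)) :
    FunctorialSigma.{u} (Fin d → G) :=
  FunctorialSigma.join fun s => Phi G (e s)

/-- `X` is fully sated: sated for every join `⋁_s Φ^{e_s}` of finitely many `Φ^{e_s}` with
`|e_s| ≥ 2`. -/
def FullySated {G : Type v} [Group G] {d : ℕ} (X : GSpace.{u} (Fin d → G)) : Prop :=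
  ∀ (r : ℕ) (e : Fin r → Finset (Fin d)), (∀ s, 2 ≤ (e s).card) → IsSated (joinPhi G e) X

/-! Part (A) comes from one extension of `X`. Put `L = L_{i,j}` and let `ρ` overwrite the entries in
`(i;j]` of a tuple by its `j`-th entry. Let `θ` overwrite them by the entry after `j` in case (1)
and by the `i`-th entry in case (2). Then `ρ g` normalizes `L`, and `θ g` lies in the coset `ρ g L`.
On `L_{e_s ∪ {j}}` (resp. `L_{e_s ∪ {i}}`) `ρ` is the identity, while `θ` maps this group into
`L_{e_s}`, because it merges the block `(i;j]` with a neighbouring block.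

The extension consists of a point `x` and, for each `c` in `Γ = G^d`, a point `y_c` drawn
independently from the fibre of `c⁻¹x` over the `L`-almost-invariant sets. The group acts by `g` on
`x`, by `θ g` on the fibre points, and by `c ↦ g c (ρ g)⁻¹` on the indices. The index `1` is fixed
by every `h` with `ρ h = h`, so a `Φ^{e_s}`-measurable function of `y_1` is measurable for the
larger set's `Φ` on the extension. For an `L`-invariant `f`, the integral of `f(x) g(y_1)` is that
of `f g` on `X`. Satedness now yields the claim (`CoindData.relIndep_of_isSated`,
`relIndep_Phi_pair`).

Part (B) is a formal consequence. Conditional independence satisfies the semigraphoid rules: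
symmetry, decomposition, weak union and contraction. From these rules, antitonicity of `Φ`, and (A)
for pairs `{p, b}`, an induction on the room between a common core `E` and an ambient set `V` gives
independence of `Φ^{e₀}` from any join over sets containing `E` (`cindep_joinOver_step`,
`cindep_joinOver_of_core`). The core starts as one common point and absorbs the nearest remaining
index, so that (A) always applies across a gap. -/

/-- Conditional independence of `m₁` and `m₂` given `m`, where `m` need not be contained in
`m₁` or `m₂`. -/
structure CIndep {Ω : Type u} [mΩ : MeasurableSpace Ω] (μ : Measure Ω)
    (m₁ m₂ m : MeasurableSpace Ω) : Prop where
  le_left : m₁ ≤ mΩ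
  le_right : m₂ ≤ mΩ
  le_base : m ≤ mΩ
  condExp_eq : ∀ A, MeasurableSet[m₁] A →
    μ[A.indicator fun _ => (1 : ℝ) | m₂ ⊔ m] =ᵐ[μ] μ[A.indicator fun _ => (1 : ℝ) | m]

/-! ### Conditional expectations and the semigraphoid rules -/

section CondExp

set_option linter.unusedSectionVars false

variable {Ω : Type u} {m m₁ m₂ m₃ n : MeasurableSpace Ω} {mΩ : MeasurableSpace Ω}
  {μ : Measure Ω} [IsProbabilityMeasure μ]

theorem memLp_top_indicator_one {A : Set Ω} (hA : MeasurableSet A) :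
    MemLp (A.indicator fun _ => (1 : ℝ)) ⊤ μ :=
  memLp_indicator_const ⊤ hA (1 : ℝ) (Or.inr (measure_ne_top μ A))

theorem stronglyMeasurable_indicator_one {A : Set Ω} (hA : MeasurableSet[m] A) :
    StronglyMeasurable[m] (A.indicator fun _ => (1 : ℝ)) :=
  stronglyMeasurable_const.indicator hA

theorem integrable_of_memLp_top {f : Ω → ℝ} (hf : MemLp f ⊤ μ) : Integrable f μ :=
  hf.integrable le_top

theorem memLp_top_condExp {f : Ω → ℝ} (hf : MemLp f ⊤ μ) : MemLp (μ[f | m]) ⊤ μ :=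
  hf.condExp le_top

theorem setIntegral_eq_integral_mul_indicator {A : Set Ω} (hA : MeasurableSet A) (f : Ω → ℝ) :
    ∫ x in A, f x ∂μ = ∫ x, f x * A.indicator (fun _ => (1 : ℝ)) x ∂μ := by
  rw [← integral_indicator hA]
  refine integral_congr_ae (Filter.Eventually.of_forall fun x => ?_)
  by_cases hx : x ∈ A <;> simp [hx]

theorem integral_mul_condExp_of_aestronglyMeasurable (hm : m ≤ mΩ) {f g : Ω → ℝ}
    (hfm : AEStronglyMeasurable[m] f μ) (hf : Integrable (f * g) μ) (hg : Integrable g μ) :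
    ∫ x, f x * (μ[g | m]) x ∂μ = ∫ x, f x * g x ∂μ := by
  have h := condExp_mul_of_aestronglyMeasurable_left hfm hf hg
  calc ∫ x, f x * (μ[g | m]) x ∂μ = ∫ x, (μ[f * g | m]) x ∂μ := integral_congr_ae h.symm
    _ = ∫ x, f x * g x ∂μ := integral_condExp hm

theorem integral_condExp_mul_condExp (hm : m ≤ mΩ) {f g : Ω → ℝ}
    (hf : MemLp f ⊤ μ) (hg : Integrable g μ) :
    ∫ x, (μ[f | m]) x * (μ[g | m]) x ∂μ = ∫ x, (μ[f | m]) x * g x ∂μ :=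
  integral_mul_condExp_of_aestronglyMeasurable hm
    stronglyMeasurable_condExp.aestronglyMeasurable
    (hg.mul_of_top_right (memLp_top_condExp hf)) hg

theorem integral_condExp_mul_condExp' (hm : m ≤ mΩ) {f g : Ω → ℝ}
    (hf : MemLp f ⊤ μ) :
    ∫ x, (μ[f | m]) x * (μ[g | m]) x ∂μ = ∫ x, f x * (μ[g | m]) x ∂μ := by
  have h := integral_mul_condExp_of_aestronglyMeasurable (μ := μ) hm (f := μ[g | m]) (g := f)
    stronglyMeasurable_condExp.aestronglyMeasurable
    (integrable_condExp.mul_of_top_left hf) (integrable_of_memLp_top hf)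
  simpa only [mul_comm] using h

/-- A π-λ argument: the intersections `A ∩ C` form a π-system generating the join. -/
theorem setIntegral_eq_of_sup (h₁ : m₁ ≤ mΩ) (h₂ : m₂ ≤ mΩ) {f g : Ω → ℝ}
    (hf : Integrable f μ) (hg : Integrable g μ)
    (h : ∀ A C, MeasurableSet[m₁] A → MeasurableSet[m₂] C →
      ∫ x in A ∩ C, f x ∂μ = ∫ x in A ∩ C, g x ∂μ)
    {S : Set Ω} (hS : MeasurableSet[m₁ ⊔ m₂] S) :
    ∫ x in S, f x ∂μ = ∫ x in S, g x ∂μ := by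
  let P : Set (Set Ω) := {s | ∃ A C, MeasurableSet[m₁] A ∧ MeasurableSet[m₂] C ∧ A ∩ C = s}
  have hgen : m₁ ⊔ m₂ = MeasurableSpace.generateFrom P := by
    refine le_antisymm (sup_le (fun A hA => ?_) fun C hC => ?_)
      (MeasurableSpace.generateFrom_le ?_)
    · exact MeasurableSpace.measurableSet_generateFrom
        ⟨A, Set.univ, hA, MeasurableSet.univ, Set.inter_univ A⟩
    · exact MeasurableSpace.measurableSet_generateFrom
        ⟨Set.univ, C, MeasurableSet.univ, hC, Set.univ_inter C⟩
    · rintro _ ⟨A, C, hA, hC, rfl⟩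
      exact MeasurableSet.inter ((le_sup_left : m₁ ≤ m₁ ⊔ m₂) _ hA)
        ((le_sup_right : m₂ ≤ m₁ ⊔ m₂) _ hC)
  have hpi : IsPiSystem P := by
    rintro _ ⟨A, C, hA, hC, rfl⟩ _ ⟨A', C', hA', hC', rfl⟩ -
    exact ⟨A ∩ A', C ∩ C', hA.inter hA', hC.inter hC', Set.inter_inter_inter_comm _ _ _ _⟩
  have hle : m₁ ⊔ m₂ ≤ mΩ := sup_le h₁ h₂
  have huniv : ∫ x, f x ∂μ = ∫ x, g x ∂μ := by
    simpa using h Set.univ Set.univ MeasurableSet.univ MeasurableSet.univ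
  refine MeasurableSpace.induction_on_inter
    (C := fun S _ => ∫ x in S, f x ∂μ = ∫ x in S, g x ∂μ) hgen hpi (by simp) ?_ ?_ ?_ S hS
  · rintro _ ⟨A, C, hA, hC, rfl⟩
    exact h A C hA hC
  · intro t ht hfg
    have e₁ := integral_add_compl (hle t ht) hf
    have e₂ := integral_add_compl (hle t ht) hg
    linarith
  · intro F hd hF hfg
    rw [integral_iUnion (fun i => hle _ (hF i)) hd hf.integrableOn,
      integral_iUnion (fun i => hle _ (hF i)) hd hg.integrableOn]
    exact tsum_congr hfg

namespace CIndep

theorem symm (h : CIndep μ m₁ m₂ m) : CIndep μ m₂ m₁ m := by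
  have h₁ := h.le_left
  have h₂ := h.le_right
  have hm := h.le_base
  refine ⟨h₂, h₁, hm, fun B hB => ?_⟩
  have hBt : MemLp (B.indicator fun _ => (1 : ℝ)) ⊤ μ := memLp_top_indicator_one (h₂ _ hB)
  have hBi := integrable_of_memLp_top hBt
  symm
  refine ae_eq_condExp_of_forall_setIntegral_eq (sup_le h₁ hm) hBi
    (fun _ _ _ => integrable_condExp.integrableOn) (fun S hS _ => ?_)
    (stronglyMeasurable_condExp.mono (le_sup_right : m ≤ m₁ ⊔ m)).aestronglyMeasurable
  refine setIntegral_eq_of_sup h₁ hm integrable_condExp hBi (fun A C hA hC => ?_) hS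
  have hAt : MemLp (A.indicator fun _ => (1 : ℝ)) ⊤ μ := memLp_top_indicator_one (h₁ _ hA)
  have hCB : MemLp ((C ∩ B).indicator fun _ => (1 : ℝ)) ⊤ μ :=
    memLp_top_indicator_one ((hm _ hC).inter (h₂ _ hB))
  have hCBm : StronglyMeasurable[m₂ ⊔ m] ((C ∩ B).indicator fun _ => (1 : ℝ)) :=
    stronglyMeasurable_indicator_one
      (MeasurableSet.inter ((le_sup_right : m ≤ m₂ ⊔ m) _ hC)
        ((le_sup_left : m₂ ≤ m₂ ⊔ m) _ hB))
  -- Since `C` belongs to the base, it can be moved from the domain of integration onto `B`. Then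
  -- the conditional expectation is moved from `C ∩ B` to `A` by self-adjointness, where the
  -- hypothesis applies.
  have hpull : μ[(C ∩ B).indicator fun _ => (1 : ℝ) | m] =ᵐ[μ]
      fun x => (μ[B.indicator fun _ => (1 : ℝ) | m]) x * C.indicator (fun _ => (1 : ℝ)) x := by
    have e : ((C ∩ B).indicator fun _ => (1 : ℝ)) = C.indicator (B.indicator fun _ => (1 : ℝ)) :=
      (Set.indicator_indicator C B _).symm
    rw [e]
    refine (condExp_indicator hBi hC).trans (Filter.Eventually.of_forall fun x => ?_)
    by_cases hx : x ∈ C <;> simp [hx]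
  rw [setIntegral_eq_integral_mul_indicator ((h₁ _ hA).inter (hm _ hC)),
    setIntegral_eq_integral_mul_indicator ((h₁ _ hA).inter (hm _ hC))]
  calc ∫ x, (μ[B.indicator fun _ => (1 : ℝ) | m]) x *
        (A ∩ C).indicator (fun _ => (1 : ℝ)) x ∂μ
      = ∫ x, A.indicator (fun _ => (1 : ℝ)) x *
          (μ[(C ∩ B).indicator fun _ => (1 : ℝ) | m]) x ∂μ := by
        refine integral_congr_ae ?_
        filter_upwards [hpull] with x hx
        rw [hx]
        by_cases hxA : x ∈ A <;> by_cases hxC : x ∈ C <;> simp [hxA, hxC]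
    _ = ∫ x, (μ[A.indicator fun _ => (1 : ℝ) | m]) x *
          (C ∩ B).indicator (fun _ => (1 : ℝ)) x ∂μ := by
        rw [← integral_condExp_mul_condExp' hm hAt,
          integral_condExp_mul_condExp hm hAt (integrable_of_memLp_top hCB)]
    _ = ∫ x, (C ∩ B).indicator (fun _ => (1 : ℝ)) x *
          (μ[A.indicator fun _ => (1 : ℝ) | m₂ ⊔ m]) x ∂μ := by
        refine integral_congr_ae ?_
        filter_upwards [h.condExp_eq A hA] with x hx
        rw [hx, mul_comm]
    _ = ∫ x, (C ∩ B).indicator (fun _ => (1 : ℝ)) x * A.indicator (fun _ => (1 : ℝ)) x ∂μ :=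
        integral_mul_condExp_of_aestronglyMeasurable (sup_le h₂ hm) hCBm.aestronglyMeasurable
          ((integrable_of_memLp_top hAt).mul_of_top_right hCB) (integrable_of_memLp_top hAt)
    _ = _ := by
        refine integral_congr_ae (Filter.Eventually.of_forall fun x => ?_)
        by_cases hxA : x ∈ A <;> by_cases hxC : x ∈ C <;> by_cases hxB : x ∈ B <;>
          simp [hxA, hxC, hxB]

theorem mono_left (h : CIndep μ m₁ m₂ m) (hn : n ≤ m₁) : CIndep μ n m₂ m :=
  ⟨hn.trans h.le_left, h.le_right, h.le_base, fun A hA => h.condExp_eq A (hn A hA)⟩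

theorem mono_right (h : CIndep μ m₁ m₂ m) (hn : n ≤ m₂) : CIndep μ m₁ n m :=
  (h.symm.mono_left hn).symm

/-- The conditional expectation given `m₂ ⊔ m` is already `m`-measurable up to null sets, so
projecting it to the intermediate `m ⊔ n` changes nothing. The new base may leave `m₁`, which is why
`RelIndep` would be too narrow here. -/
theorem weak_union (h : CIndep μ m₁ m₂ m) (hn : n ≤ m₂) : CIndep μ m₁ m₂ (m ⊔ n) := by
  have hle : m₂ ⊔ m ≤ mΩ := sup_le h.le_right h.le_base
  have hmn : m ⊔ n ≤ m₂ ⊔ m := sup_le le_sup_right (hn.trans le_sup_left)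
  refine ⟨h.le_left, h.le_right, hmn.trans hle, fun A hA => ?_⟩
  have e : m₂ ⊔ (m ⊔ n) = m₂ ⊔ m :=
    le_antisymm (sup_le le_sup_left hmn) (sup_le_sup_left le_sup_left _)
  rw [e]
  have h₁ := h.condExp_eq A hA
  have h₂ : μ[μ[A.indicator fun _ => (1 : ℝ) | m₂ ⊔ m] | m ⊔ n] =ᵐ[μ]
      μ[A.indicator fun _ => (1 : ℝ) | m ⊔ n] := condExp_condExp_of_le hmn hle
  have h₃ : μ[μ[A.indicator fun _ => (1 : ℝ) | m₂ ⊔ m] | m ⊔ n] =ᵐ[μ]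
      μ[μ[A.indicator fun _ => (1 : ℝ) | m] | m ⊔ n] := condExp_congr_ae h₁
  rw [condExp_of_stronglyMeasurable (hmn.trans hle)
    (stronglyMeasurable_condExp.mono le_sup_left) integrable_condExp] at h₃
  exact h₁.trans (h₃.symm.trans h₂)

theorem weak_union_left (h : CIndep μ m₁ m₂ m) (hn : n ≤ m₁) : CIndep μ m₁ m₂ (m ⊔ n) :=
  (h.symm.weak_union hn).symm

theorem contraction (h₁ : CIndep μ m₁ m₂ m) (h₂ : CIndep μ m₁ m₃ (m₂ ⊔ m)) :
    CIndep μ m₁ (m₂ ⊔ m₃) m := by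
  refine ⟨h₁.le_left, sup_le h₁.le_right h₂.le_right, h₁.le_base, fun A hA => ?_⟩
  have e : m₂ ⊔ m₃ ⊔ m = m₃ ⊔ (m₂ ⊔ m) := by rw [sup_comm m₂ m₃, sup_assoc]
  rw [e]
  exact (h₂.condExp_eq A hA).trans (h₁.condExp_eq A hA)

theorem refl_right (h₁ : m₁ ≤ mΩ) (hm : m ≤ mΩ) : CIndep μ m₁ m m :=
  ⟨h₁, hm, hm, fun A _ => by rw [sup_idem]⟩

theorem of_relIndep (h : RelIndep μ m₁ m₂ m) : CIndep μ m₁ m₂ m := by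
  have hm := h.base_le_left.trans h.le_left
  refine ⟨h.le_left, h.le_right, hm, fun A hA => ?_⟩
  rw [sup_eq_left.2 h.base_le_right]
  have hAt : MemLp (A.indicator fun _ => (1 : ℝ)) ⊤ μ := memLp_top_indicator_one (h.le_left _ hA)
  symm
  refine ae_eq_condExp_of_forall_setIntegral_eq h.le_right (integrable_of_memLp_top hAt)
    (fun _ _ _ => integrable_condExp.integrableOn) (fun B hB _ => ?_)
    (stronglyMeasurable_condExp.mono h.base_le_right).aestronglyMeasurable
  have hBt : MemLp (B.indicator fun _ => (1 : ℝ)) ⊤ μ := memLp_top_indicator_one (h.le_right _ hB)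
  rw [setIntegral_eq_integral_mul_indicator (h.le_right _ hB),
    setIntegral_eq_integral_mul_indicator (h.le_right _ hB),
    h.integral_mul _ _ (stronglyMeasurable_indicator_one hA).aestronglyMeasurable hAt
      (stronglyMeasurable_indicator_one hB).aestronglyMeasurable hBt,
    integral_condExp_mul_condExp hm hAt (integrable_of_memLp_top hBt)]

/-- Independence is used in the reversed direction, on indicators of `m₂`-sets. It is then tested
against `g`, so no approximation of an integrable `g` is needed. -/
theorem condExp_ae_eq (h : CIndep μ m₁ m₂ m) (hm : m ≤ m₂) {g : Ω → ℝ}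
    (hgm : AEStronglyMeasurable[m₁] g μ) (hg : Integrable g μ) :
    μ[g | m₂] =ᵐ[μ] μ[g | m] := by
  have h₁ := h.le_left
  have h₂ := h.le_right
  symm
  refine ae_eq_condExp_of_forall_setIntegral_eq h₂ hg
    (fun _ _ _ => integrable_condExp.integrableOn) (fun A hA _ => ?_)
    (stronglyMeasurable_condExp.mono hm).aestronglyMeasurable
  have hAt : MemLp (A.indicator fun _ => (1 : ℝ)) ⊤ μ := memLp_top_indicator_one (h₂ _ hA)
  have hAi := integrable_of_memLp_top hAt
  have hbdd : ∀ {n : MeasurableSpace Ω}, MemLp (μ[A.indicator fun _ => (1 : ℝ) | n]) ⊤ μ :=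
    memLp_top_condExp hAt
  rw [setIntegral_eq_integral_mul_indicator (h₂ _ hA),
    setIntegral_eq_integral_mul_indicator (h₂ _ hA)]
  have e₁ : ∫ x, (μ[g | m]) x * A.indicator (fun _ => (1 : ℝ)) x ∂μ =
      ∫ x, g x * (μ[A.indicator fun _ => (1 : ℝ) | m]) x ∂μ := by
    have e := (integral_condExp_mul_condExp h.le_base hAt hg).symm.trans
      (integral_condExp_mul_condExp' h.le_base hAt)
    simp only [mul_comm (g _), mul_comm ((μ[g | m]) _)]
    exact e.symm
  have e₂ : ∫ x, g x * (μ[A.indicator fun _ => (1 : ℝ) | m₁ ⊔ m]) x ∂μ =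
      ∫ x, g x * A.indicator (fun _ => (1 : ℝ)) x ∂μ :=
    integral_mul_condExp_of_aestronglyMeasurable (sup_le h₁ h.le_base)
      (hgm.mono le_sup_left) (hg.mul_of_top_left hAt) hAi
  rw [e₁, ← e₂]
  refine integral_congr_ae ?_
  filter_upwards [h.symm.condExp_eq A hA] with x hx
  rw [hx]

end CIndep

end CondExp

/-! ### Disintegration over the almost-invariant sets and its equivariance -/

section InvariantKernel

open ProbabilityTheory

variable {Γ : Type v} [Group Γ] (X : GSpace.{u} Γ)

theorem GSpace.invariantSigma_le (H : Subgroup Γ) : X.invariantSigma H ≤ X.measurableSpace :=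
  fun _ hA => hA.1

theorem GSpace.invariantSigma_anti {H K : Subgroup Γ} (h : H ≤ K) :
    X.invariantSigma K ≤ X.invariantSigma H :=
  fun _ hA => ⟨hA.1, fun g hg => hA.2 g (h hg)⟩

theorem GSpace.measurableSet_preimage_smul {L : Subgroup Γ} {k : Γ}
    (hk : ∀ l ∈ L, k * l * k⁻¹ ∈ L) {A : Set X.carrier}
    (hA : MeasurableSet[X.invariantSigma L] A) :
    MeasurableSet[X.invariantSigma L] ((fun x => k • x) ⁻¹' A) := by
  refine ⟨measurable_const_smul k hA.1, fun l hl => ?_⟩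
  have h := (measurePreserving_smul k X.μ).quasiMeasurePreserving.preimage_ae_eq
    (hA.2 _ (hk l hl))
  have e : (fun x : X.carrier => l • x) ⁻¹' ((fun x => k • x) ⁻¹' A) =
      (fun x => k • x) ⁻¹' ((fun x => (k * l * k⁻¹) • x) ⁻¹' A) := by
    ext x
    simp [← mul_smul]
  rw [e]
  exact h

/-- The disintegration of `X.μ` over the `σ`-algebra of `L`-almost-invariant sets. -/
noncomputable def GSpace.invariantKernel (L : Subgroup Γ) : Kernel X.carrier X.carrier :=
  (condExpKernel X.μ (X.invariantSigma L)).comap id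
    (measurable_id'' (X.invariantSigma_le L))

instance (L : Subgroup Γ) : IsMarkovKernel (X.invariantKernel L) := by
  unfold GSpace.invariantKernel
  infer_instance

theorem GSpace.invariantKernel_ae_eq (L : Subgroup Γ) {s : Set X.carrier} (hs : MeasurableSet s) :
    (fun x => (X.invariantKernel L x).real s) =ᵐ[X.μ]
      (X.μ)[s.indicator fun _ => (1 : ℝ) | X.invariantSigma L] :=
  condExpKernel_ae_eq_condExp (X.invariantSigma_le L) hs

theorem GSpace.condExp_ae_eq_integral_invariantKernel (L : Subgroup Γ) {f : X.carrier → ℝ}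
    (hf : Integrable f X.μ) :
    (X.μ)[f | X.invariantSigma L] =ᵐ[X.μ] fun x => ∫ y, f y ∂(X.invariantKernel L x) :=
  condExp_ae_eq_integral_condExpKernel (X.invariantSigma_le L) hf

/-- Translation by `k` permutes the `L`-almost-invariant sets because `k` normalizes `L`, and `a = k
l` with `l ∈ L` acts on these sets as `k` does. Hence `k` on the base and `a` on the fibres are
compatible. -/
theorem GSpace.condExp_indicator_preimage_smul {L : Subgroup Γ} {k a : Γ}
    (hk : ∀ l ∈ L, k * l * k⁻¹ ∈ L) (hk' : ∀ l ∈ L, k⁻¹ * l * k ∈ L) (ha : k⁻¹ * a ∈ L)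
    {t : Set X.carrier} (ht : MeasurableSet t) :
    (fun x => ((X.μ)[((fun y => a • y) ⁻¹' t).indicator fun _ => (1 : ℝ) |
        X.invariantSigma L]) (k⁻¹ • x)) =ᵐ[X.μ]
      (X.μ)[t.indicator fun _ => (1 : ℝ) | X.invariantSigma L] := by
  have hat : MeasurableSet ((fun y : X.carrier => a • y) ⁻¹' t) := measurable_const_smul a ht
  have hint : Integrable (((fun y : X.carrier => a • y) ⁻¹' t).indicator fun _ => (1 : ℝ)) X.μ :=
    integrable_of_memLp_top (memLp_top_indicator_one hat)
  have hemb : MeasurableEmbedding (fun x : X.carrier => k⁻¹ • x) := measurableEmbedding_const_smul _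
  have hmeas : @Measurable _ _ (X.invariantSigma L) (X.invariantSigma L)
      (fun x : X.carrier => k⁻¹ • x) :=
    fun A hA => X.measurableSet_preimage_smul (by simpa using hk') hA
  refine ae_eq_condExp_of_forall_setIntegral_eq (X.invariantSigma_le L)
    (integrable_of_memLp_top (memLp_top_indicator_one ht)) (fun A _ _ => ?_) (fun A hA _ => ?_)
    (stronglyMeasurable_condExp.comp_measurable hmeas).aestronglyMeasurable
  · exact (((measurePreserving_smul k⁻¹ X.μ).integrable_comp_emb hemb).2
      integrable_condExp).integrableOn
  · have hA' := X.measurableSet_preimage_smul hk hA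
    have e₁ : A = (fun x : X.carrier => k⁻¹ • x) ⁻¹' ((fun x : X.carrier => k • x) ⁻¹' A) := by
      ext x; simp
    have e₂ : (((fun x : X.carrier => k • x) ⁻¹' A) ∩
        ((fun y : X.carrier => a • y) ⁻¹' t) : Set X.carrier) =ᵐ[X.μ]
          ((fun y : X.carrier => a • y) ⁻¹' (A ∩ t) : Set X.carrier) := by
      have e : (fun y : X.carrier => a • y) ⁻¹' (A ∩ t) =
          ((fun x : X.carrier => (k⁻¹ * a) • x) ⁻¹' ((fun x : X.carrier => k • x) ⁻¹' A)) ∩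
            ((fun y : X.carrier => a • y) ⁻¹' t) := by
        ext x
        simp [← mul_smul]
      rw [e]
      exact (ae_eq_set_inter (hA'.2 _ ha) Filter.EventuallyEq.rfl).symm
    conv_lhs => rw [e₁]
    rw [(measurePreserving_smul k⁻¹ X.μ).setIntegral_preimage_emb hemb,
      setIntegral_condExp (X.invariantSigma_le L) hint hA', setIntegral_indicator hat,
      setIntegral_indicator ht]
    simp only [setIntegral_const, smul_eq_mul, mul_one]
    rw [measureReal_congr e₂]
    exact (measurePreserving_smul a X.μ).measureReal_preimage (hA.1.inter ht).nullMeasurableSet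

theorem GSpace.invariantKernel_map_smul {L : Subgroup Γ} {k a : Γ}
    (hk : ∀ l ∈ L, k * l * k⁻¹ ∈ L) (hk' : ∀ l ∈ L, k⁻¹ * l * k ∈ L) (ha : k⁻¹ * a ∈ L) :
    ∀ᵐ x ∂X.μ, (X.invariantKernel L (k⁻¹ • x)).map (fun y => a • y) = X.invariantKernel L x := by
  have hma : Measurable (fun y : X.carrier => a • y) := measurable_const_smul a
  have hmk : Measurable (fun y : X.carrier => k⁻¹ • y) := measurable_const_smul k⁻¹
  let η : Kernel X.carrier X.carrier :=
    ((X.invariantKernel L).comap (fun x => k⁻¹ • x) hmk).map fun y => a • y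
  have hη : ∀ x, η x = (X.invariantKernel L (k⁻¹ • x)).map (fun y => a • y) := fun x => by
    simp only [η, Kernel.map_apply _ hma, Kernel.comap_apply]
  have : IsMarkovKernel η := Kernel.IsMarkovKernel.map _ hma
  have key : η =ᵐ[X.μ] X.invariantKernel L := by
    -- Comparing the composition products on rectangles turns an almost sure identity for each `t`
    -- into an almost sure identity of measures.
    refine Kernel.ae_eq_of_compProd_eq (Measure.ext_prod_iff.2 fun {s t} hs ht => ?_)
    rw [Measure.compProd_apply_prod hs ht, Measure.compProd_apply_prod hs ht]
    refine setLIntegral_congr_fun_ae hs ?_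
    have h₁ := (measurePreserving_smul k⁻¹ X.μ).quasiMeasurePreserving.ae_eq_comp
      (X.invariantKernel_ae_eq L (hma ht))
    filter_upwards [h₁, X.invariantKernel_ae_eq L ht,
      X.condExp_indicator_preimage_smul hk hk' ha ht] with x e₁ e₂ e₃ _
    have e₄ : (X.invariantKernel L (k⁻¹ • x)).real ((fun y => a • y) ⁻¹' t) =
        (X.invariantKernel L x).real t := e₁.trans (e₃.trans e₂.symm)
    rw [hη, Measure.map_apply hma ht]
    exact (measureReal_eq_measureReal_iff).1 e₄
  filter_upwards [key] with x hx
  rw [← hη, hx]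

end InvariantKernel

/-! ### Independent families of points -/

section ProductKernel

open ProbabilityTheory

/-- The kernel that draws independent points with laws `κ (p i x)`, for `i : ι`. -/
noncomputable def productKernel {α β : Type*} {ι : Type*} [MeasurableSpace α] [MeasurableSpace β]
    (κ : Kernel α β) [IsMarkovKernel κ] (p : ι → α → α) (hp : ∀ i, Measurable (p i)) :
    Kernel α (ι → β) where
  toFun x := Measure.infinitePi fun i => κ (p i x)
  measurable' := by
    refine Measurable.measure_of_isPiSystem_of_isProbabilityMeasure generateFrom_squareCylinders.symm
      (isPiSystem_squareCylinders (fun _ => MeasurableSpace.isPiSystem_measurableSet)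
        fun _ => MeasurableSet.univ) ?_
    rintro _ ⟨s, t, ht, rfl⟩
    have ht' : ∀ i, MeasurableSet (t i) := fun i => ht i (Set.mem_univ i)
    simp only [Measure.infinitePi_pi _ (fun i _ => ht' i)]
    exact Finset.measurable_prod _ fun i _ => (κ.measurable_coe (ht' i)).comp (hp i)

theorem productKernel_apply {α β : Type*} {ι : Type*} [MeasurableSpace α] [MeasurableSpace β]
    (κ : Kernel α β) [IsMarkovKernel κ] (p : ι → α → α) (hp : ∀ i, Measurable (p i)) (x : α) :
    productKernel κ p hp x = Measure.infinitePi fun i => κ (p i x) := rfl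

instance {α β : Type*} {ι : Type*} [MeasurableSpace α] [MeasurableSpace β]
    (κ : Kernel α β) [IsMarkovKernel κ] (p : ι → α → α) (hp : ∀ i, Measurable (p i)) :
    IsMarkovKernel (productKernel κ p hp) :=
  ⟨fun x => by rw [productKernel_apply]; infer_instance⟩

theorem infinitePi_map_permute {α β : Type*} {ι : Type*} [MeasurableSpace α] [MeasurableSpace β]
    (P : ι → Measure α) [∀ i, IsProbabilityMeasure (P i)] (Q : ι → Measure β)
    [∀ i, IsProbabilityMeasure (Q i)] (e : ι ≃ ι) (f : α → β) (hf : Measurable f)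
    (h : ∀ i, (P (e i)).map f = Q i) :
    (Measure.infinitePi P).map (fun y i => f (y (e i))) = Measure.infinitePi Q := by
  classical
  refine Measure.eq_infinitePi _ fun s t ht => ?_
  have hm : Measurable fun (y : ι → α) i => f (y (e i)) := by fun_prop
  have hpre : (fun (y : ι → α) i => f (y (e i))) ⁻¹' (s : Set ι).pi t =
      ((s.map e.toEmbedding : Finset ι) : Set ι).pi fun i => f ⁻¹' t (e.symm i) := by
    ext y
    simp only [Set.mem_preimage, Set.mem_pi, Finset.coe_map, Equiv.coe_toEmbedding,
      Set.forall_mem_image, Equiv.symm_apply_apply]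
  rw [Measure.map_apply hm (MeasurableSet.pi s.countable_toSet fun i _ => ht i), hpre,
    Measure.infinitePi_pi _ fun i _ => hf (ht _), Finset.prod_map]
  refine Finset.prod_congr rfl fun i _ => ?_
  rw [← h i, Measure.map_apply hf (ht i)]
  simp

end ProductKernel

/-! ### The coinduced extension -/

section Coinduction

open ProbabilityTheory

variable {Γ : Type v} [Group Γ]

/-- The data from which a `Γ`-extension of `X` is built by independent coinduction: endomorphisms
`ρ`, `θ` of `Γ` for which `θ` lifts `ρ` modulo a subgroup `L` normalized by the image of `ρ`, and
a `Γ`-set `ι` with a `ρ`-twisted equivariant map to `Γ`. -/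
structure CoindData (Γ : Type v) [Group Γ] where
  L : Subgroup Γ
  ρ : Γ →* Γ
  θ : Γ →* Γ
  ι : Type u
  [countable : Countable ι]
  [action : MulAction Γ ι]
  σ : ι → Γ
  normalizes : ∀ g, ∀ l ∈ L, ρ g * l * (ρ g)⁻¹ ∈ L
  lifts : ∀ g, (ρ g)⁻¹ * θ g ∈ L
  equivariant : ∀ g c, σ (g • c) = g * σ c * (ρ g)⁻¹

namespace CoindData

attribute [instance] countable action

variable (D : CoindData.{u} Γ) (X : GSpace.{u} Γ)

/-- The kernel drawing independent points from the fibres over the `L`-almost-invariant sets. -/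
noncomputable def fibreKernel : Kernel X.carrier (D.ι → X.carrier) :=
  productKernel (X.invariantKernel D.L) (fun c x => (D.σ c)⁻¹ • x)
    fun c => measurable_const_smul (D.σ c)⁻¹

instance : IsMarkovKernel (D.fibreKernel X) := by
  unfold fibreKernel
  infer_instance

/-- The law of a point of `X` together with independent points of the fibres. -/
noncomputable def measure : Measure (X.carrier × (D.ι → X.carrier)) := X.μ ⊗ₘ D.fibreKernel X

instance : IsProbabilityMeasure (D.measure X) := by
  unfold measure
  infer_instance

/-- The transformation by `g` of the points of the fibres. -/
def fibreMap (g : Γ) (y : D.ι → X.carrier) : D.ι → X.carrier := fun c => D.θ g • y (g⁻¹ • c)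

/-- The transformation by `g` of the coinduced space. -/
def map (g : Γ) (z : X.carrier × (D.ι → X.carrier)) : X.carrier × (D.ι → X.carrier) :=
  (g • z.1, D.fibreMap X g z.2)

theorem measurable_fibreMap (g : Γ) : Measurable (D.fibreMap X g) :=
  measurable_pi_lambda _ fun c =>
    (measurable_const_smul (D.θ g)).comp (measurable_pi_apply (g⁻¹ • c))

theorem measurable_map (g : Γ) : Measurable (D.map X g) :=
  ((measurable_const_smul g).comp measurable_fst).prodMk
    ((D.measurable_fibreMap X g).comp measurable_snd)

theorem map_one (z : X.carrier × (D.ι → X.carrier)) : D.map X 1 z = z :=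
  Prod.ext (one_smul Γ z.1) (funext fun c => by simp [map, fibreMap])

theorem map_mul (g h : Γ) (z : X.carrier × (D.ι → X.carrier)) :
    D.map X (g * h) z = D.map X g (D.map X h z) :=
  Prod.ext (mul_smul g h z.1) (funext fun c => by simp [map, fibreMap, mul_smul])

theorem fibreKernel_map (g : Γ) :
    ∀ᵐ x ∂X.μ, (D.fibreKernel X x).map (D.fibreMap X g) = D.fibreKernel X (g • x) := by
  have hk : ∀ l ∈ D.L, D.ρ g * l * (D.ρ g)⁻¹ ∈ D.L := D.normalizes g
  have hk' : ∀ l ∈ D.L, (D.ρ g)⁻¹ * l * D.ρ g ∈ D.L := by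
    simpa using D.normalizes g⁻¹
  have h₀ := X.invariantKernel_map_smul hk hk' (D.lifts g)
  -- Countability of the index set allows one null set for all indices.
  have h₁ : ∀ᵐ x ∂X.μ, ∀ c, (X.invariantKernel D.L ((D.ρ g)⁻¹ • ((D.σ c)⁻¹ * g) • x)).map
      (fun y => D.θ g • y) = X.invariantKernel D.L (((D.σ c)⁻¹ * g) • x) :=
    ae_all_iff.2 fun c =>
      (measurePreserving_smul ((D.σ c)⁻¹ * g) X.μ).quasiMeasurePreserving.ae h₀
  filter_upwards [h₁] with x hx
  refine infinitePi_map_permute _ _ (MulAction.toPerm g⁻¹) (fun y => D.θ g • y)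
    (measurable_const_smul (D.θ g)) fun c => ?_
  -- The twisted equivariance of `σ` is designed for this identity: the base point of the fibre of
  -- index `g⁻¹ • c` differs by `(ρ g)⁻¹` from that of index `c` after moving `x` by `g`.
  have e : (D.σ (MulAction.toPerm g⁻¹ c))⁻¹ • x = (D.ρ g)⁻¹ • ((D.σ c)⁻¹ * g) • x := by
    rw [MulAction.toPerm_apply, D.equivariant, ← mul_smul]
    simp [mul_assoc]
  change ((X.invariantKernel D.L) ((D.σ (MulAction.toPerm g⁻¹ c))⁻¹ • x)).map _ =
    (X.invariantKernel D.L) ((D.σ c)⁻¹ • g • x)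
  rw [e, hx c, mul_smul]

theorem measurePreserving_map (g : Γ) :
    MeasurePreserving (D.map X g) (D.measure X) (D.measure X) := by
  refine ⟨D.measurable_map X g, Measure.ext_prod_iff.2 fun {s t} hs ht => ?_⟩
  have hpre : D.map X g ⁻¹' s ×ˢ t =
      ((fun x : X.carrier => g • x) ⁻¹' s) ×ˢ (D.fibreMap X g ⁻¹' t) := rfl
  have hgs : MeasurableSet ((fun x : X.carrier => g • x) ⁻¹' s) := measurable_const_smul g hs
  rw [Measure.map_apply (D.measurable_map X g) (hs.prod ht), hpre, measure,
    Measure.compProd_apply_prod hgs (D.measurable_fibreMap X g ht),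
    Measure.compProd_apply_prod hs ht,
    ← (measurePreserving_smul g X.μ).setLIntegral_comp_preimage hs
      ((D.fibreKernel X).measurable_coe ht)]
  refine setLIntegral_congr_fun_ae hgs ?_
  filter_upwards [D.fibreKernel_map X g] with x hx _
  rw [← hx, Measure.map_apply (D.measurable_fibreMap X g) ht]

/-- The action of `Γ` on the coinduced space. -/
@[reducible]
def mulAction : MulAction Γ (X.carrier × (D.ι → X.carrier)) where
  smul := D.map X
  one_smul := D.map_one X
  mul_smul := D.map_mul X

/-- The coinduced `Γ`-space. -/
noncomputable def space : GSpace.{u} Γ where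
  carrier := X.carrier × (D.ι → X.carrier)
  action := D.mulAction X
  measurableAction := @MeasurableConstSMul.mk _ _ (D.mulAction X).toSMul _ (D.measurable_map X)
  μ := D.measure X
  invariant := @SMulInvariantMeasure.mk _ _ (D.mulAction X).toSMul _ _ fun g _ hs =>
    (D.measurePreserving_map X g).measure_preimage hs.nullMeasurableSet

theorem measurePreserving_fst :
    MeasurePreserving (Prod.fst : X.carrier × (D.ι → X.carrier) → X.carrier)
      (D.measure X) X.μ :=
  ⟨measurable_fst, Measure.fst_compProd X.μ (D.fibreKernel X)⟩

theorem isExtension_fst : GSpace.IsExtension (D.space X) X Prod.fst :=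
  ⟨D.measurePreserving_fst X, fun _ => Filter.Eventually.of_forall fun _ => rfl⟩

theorem map_eval_fibreKernel {c : D.ι} (hc : D.σ c = 1) (x : X.carrier) :
    (D.fibreKernel X x).map (fun y => y c) = X.invariantKernel D.L x := by
  have h := Measure.infinitePi_map_eval
    (fun c => X.invariantKernel D.L ((D.σ c)⁻¹ • x)) c
  simp only [hc, inv_one, one_smul] at h
  exact h

/-- Averaging the fibre measures over the base gives back the law `X.μ`. -/
theorem measurePreserving_eval {c : D.ι} (hc : D.σ c = 1) :
    MeasurePreserving (fun z : X.carrier × (D.ι → X.carrier) => z.2 c) (D.measure X) X.μ := by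
  have hm : Measurable fun z : X.carrier × (D.ι → X.carrier) => z.2 c :=
    (measurable_pi_apply c).comp measurable_snd
  refine ⟨hm, Measure.ext fun t ht => ?_⟩
  have e₁ : (D.measure X).map (fun z => z.2 c) t = ∫⁻ x, X.invariantKernel D.L x t ∂X.μ := by
    rw [Measure.map_apply hm ht, measure, Measure.compProd_apply (hm ht)]
    refine lintegral_congr fun x => ?_
    rw [← D.map_eval_fibreKernel X hc x, Measure.map_apply (measurable_pi_apply c) ht]
    rfl
  have e₂ : (∫⁻ x, X.invariantKernel D.L x t ∂X.μ).toReal = (X.μ t).toReal := by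
    rw [← integral_toReal ((X.invariantKernel D.L).measurable_coe ht).aemeasurable
      (Filter.Eventually.of_forall fun x => measure_lt_top (X.invariantKernel D.L x) t)]
    refine (integral_congr_ae (X.invariantKernel_ae_eq D.L ht)).trans ?_
    rw [integral_condExp (X.invariantSigma_le D.L), integral_indicator ht]
    simp [Measure.real]
  rw [e₁]
  refine (ENNReal.toReal_eq_toReal_iff' ?_ (measure_ne_top _ _)).1 e₂
  rw [← e₁]
  have := Measure.isProbabilityMeasure_map (μ := D.measure X) hm.aemeasurable
  exact measure_ne_top _ _

/-- For `L`-almost-invariant functions, the point of the fibre over the base point cannot be told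
from the base point. -/
theorem integral_mul_eval {c : D.ι} (hc : D.σ c = 1) {f g : X.carrier → ℝ}
    (hfm : AEStronglyMeasurable[X.invariantSigma D.L] f X.μ) (hf : MemLp f ⊤ X.μ)
    (hgm : StronglyMeasurable g) (hg : MemLp g ⊤ X.μ) :
    ∫ z, f z.1 * g (z.2 c) ∂(D.measure X) = ∫ x, f x * g x ∂X.μ := by
  have hgi := integrable_of_memLp_top hg
  have hint : Integrable (fun z : X.carrier × (D.ι → X.carrier) => f z.1 * g (z.2 c))
      (D.measure X) :=
    Integrable.mul_of_top_right
      (integrable_of_memLp_top (hg.comp_measurePreserving (D.measurePreserving_eval X hc)))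
      (hf.comp_measurePreserving (D.measurePreserving_fst X))
  have hker := X.condExp_ae_eq_integral_invariantKernel D.L hgi
  rw [← integral_mul_condExp_of_aestronglyMeasurable (X.invariantSigma_le D.L) hfm
    (hgi.mul_of_top_right hf) hgi, measure, Measure.integral_compProd hint]
  refine integral_congr_ae ?_
  filter_upwards [hker] with x hx
  rw [hx, ← D.map_eval_fibreKernel X hc x,
    integral_map (measurable_pi_apply c).aemeasurable hgm.aestronglyMeasurable]
  exact integral_const_mul _ _

end CoindData

end Coinduction

/-! ### From satedness to relative independence -/

section Sated

variable {Γ : Type v} [Group Γ]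

theorem CoindData.smul_snd (D : CoindData.{u} Γ) (X : GSpace.{u} Γ) (g : Γ) {c : D.ι}
    (hgc : g⁻¹ • c = c) (z : (D.space X).carrier) : (g • z).2 c = D.θ g • z.2 c := by
  change D.θ g • z.2 (g⁻¹ • c) = _
  rw [hgc]

/-- A set that is almost invariant under `H` pulls back under the point of the fibre of index `c`
to a set that is almost invariant under `H'`. -/
theorem CoindData.comap_eval_le (D : CoindData.{u} Γ) (X : GSpace.{u} Γ) {c : D.ι}
    (hc : D.σ c = 1) {H H' : Subgroup Γ} (hfix : ∀ h ∈ H', h • c = c) (hθ : ∀ h ∈ H', D.θ h ∈ H) :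
    (X.invariantSigma H).comap (fun z : (D.space X).carrier => z.2 c) ≤
      (D.space X).invariantSigma H' := by
  rintro _ ⟨A, hA, rfl⟩
  have hP : MeasurePreserving (fun z : (D.space X).carrier => z.2 c) (D.space X).μ X.μ :=
    D.measurePreserving_eval X hc
  refine ⟨hP.measurable hA.1, fun h hh => ?_⟩
  have e : (fun z : (D.space X).carrier => h • z) ⁻¹'
      ((fun z : (D.space X).carrier => z.2 c) ⁻¹' A) =
      (fun z : (D.space X).carrier => z.2 c) ⁻¹' ((fun x => D.θ h • x) ⁻¹' A) := by
    ext z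
    simp only [Set.mem_preimage]
    rw [D.smul_snd X h (hfix h⁻¹ (inv_mem hh))]
  rw [e]
  exact hP.quasiMeasurePreserving.preimage_ae_eq (hA.2 _ (hθ h hh))

theorem condExp_comp_of_measurePreserving {α β : Type*} {mα : MeasurableSpace α}
    {m mβ : MeasurableSpace β} {μ : Measure α} [IsProbabilityMeasure μ] {ν : Measure β}
    [IsProbabilityMeasure ν] {π : α → β}
    (hπ : MeasurePreserving π μ ν) (hm : m ≤ mβ) {f : β → ℝ}
    (hf : Integrable f ν) :
    μ[f ∘ π | m.comap π] =ᵐ[μ] (ν[f | m]) ∘ π := by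
  have hle : m.comap π ≤ mα := (MeasurableSpace.comap_mono hm).trans hπ.measurable.comap_le
  symm
  refine ae_eq_condExp_of_forall_setIntegral_eq hle (hπ.integrable_comp_of_integrable hf)
    (fun _ _ _ => ((hπ.integrable_comp_of_integrable integrable_condExp)).integrableOn) ?_
    (stronglyMeasurable_condExp.comp_measurable (comap_measurable π)).aestronglyMeasurable
  rintro _ ⟨A, hA, rfl⟩ _
  have key : ∀ g : β → ℝ, Integrable g ν →
      ∫ x in π ⁻¹' A, (g ∘ π) x ∂μ = ∫ y in A, g y ∂ν := fun g hg => by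
    rw [← (hπ.restrict_preimage (hm _ hA)).map_eq, integral_map hπ.measurable.aemeasurable]
    · rfl
    · rw [(hπ.restrict_preimage (hm _ hA)).map_eq]
      exact hg.aestronglyMeasurable.restrict
  rw [key _ integrable_condExp, key _ hf, setIntegral_condExp hm hf hA]

/-- Relative independence on a factor follows from relative independence of the factor from a
second copy of `m₂`, when `m₁`-measurable functions correlate with the second copy as with the
first. -/
theorem RelIndep.of_joining {Ω : Type*} {Ω' : Type*} {m₁ m₂ m mΩ : MeasurableSpace Ω}
    {n mΩ' : MeasurableSpace Ω'} {μ : Measure Ω} [IsProbabilityMeasure μ] {μ' : Measure Ω'}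
    [IsProbabilityMeasure μ'] {p q : Ω' → Ω} (hp : MeasurePreserving p μ' μ)
    (hq : MeasurePreserving q μ' μ) (h₁ : m₁ ≤ mΩ) (h₂ : m₂ ≤ mΩ) (hm₁ : m ≤ m₁) (hm₂ : m ≤ m₂)
    (hS : RelIndep μ' (mΩ.comap p) n (m.comap p)) (hle : m₂.comap q ≤ n)
    (hpq : ∀ f g : Ω → ℝ, AEStronglyMeasurable[m₁] f μ → MemLp f ⊤ μ →
      StronglyMeasurable g → MemLp g ⊤ μ →
        ∫ z, f (p z) * g (q z) ∂μ' = ∫ x, f x * g x ∂μ) :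
    RelIndep μ m₁ m₂ m := by
  have hm : m ≤ mΩ := hm₂.trans h₂
  refine ⟨h₁, h₂, hm₁, hm₂, fun f g hfm hf hgm hg => ?_⟩
  obtain ⟨g', hg'm, hgg'⟩ := hgm
  have hg' : MemLp g' ⊤ μ := (memLp_congr_ae hgg').1 hg
  have hbase : m.comap p ≤ mΩ' := hS.base_le_left.trans hS.le_left
  have hF : MemLp (f ∘ p) ⊤ μ' := hf.comp_measurePreserving hp
  have hG : MemLp (g' ∘ q) ⊤ μ' := hg'.comp_measurePreserving hq
  have hfmk : AEStronglyMeasurable[mΩ.comap p] (f ∘ p) μ' :=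
    ⟨_, hf.1.stronglyMeasurable_mk.comp_measurable (comap_measurable p),
      hp.quasiMeasurePreserving.ae_eq_comp hf.1.ae_eq_mk⟩
  have hgmk : AEStronglyMeasurable[n] (g' ∘ q) μ' :=
    ((hg'm.comp_measurable (comap_measurable q)).mono hle).aestronglyMeasurable
  have key := hS.integral_mul _ _ hfmk hF hgmk hG
  -- Because `m ≤ m₁`, the projection of `f` to `m` is itself a legitimate first argument. The
  -- joining formula thus serves twice: for `f`, and for what satedness leaves of `f`.
  have e₂ := hpq _ _ (stronglyMeasurable_condExp.mono hm₁).aestronglyMeasurable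
    (memLp_top_condExp (m := m) hf) (hg'm.mono h₂) hg'
  have e₃ := integral_condExp_mul_condExp hbase hF (integrable_of_memLp_top hG)
  have e₄ := condExp_comp_of_measurePreserving hp hm (integrable_of_memLp_top hf)
  calc ∫ x, f x * g x ∂μ = ∫ x, f x * g' x ∂μ :=
        integral_congr_ae (hgg'.mono fun x hx => by simp only [hx])
    _ = ∫ z, f (p z) * g' (q z) ∂μ' := (hpq f g' hfm hf (hg'm.mono h₂) hg').symm
    _ = _ := key.trans e₃
    _ = ∫ z, (μ[f | m]) (p z) * g' (q z) ∂μ' := integral_congr_ae (e₄.mono fun z hz => by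
        simp only [hz, Function.comp_apply])
    _ = _ := e₂
    _ = _ := (integral_condExp_mul_condExp hm hf (integrable_of_memLp_top hg')).symm
    _ = _ := integral_congr_ae ((condExp_congr_ae (m := m) hgg').mono fun x hx => by
        simp only [hx])

/-- The second copy of `X` is the fibre point of index `c`. Since `H' s` fixes `c` and `θ` sends it
into `H s`, sets invariant under `H s` pull back into the join for which `X` is sated. -/
theorem CoindData.relIndep_of_isSated (D : CoindData.{u} Γ) (X : GSpace.{u} Γ) {c : D.ι}
    (hc : D.σ c = 1) {κ : Type} (H H' : κ → Subgroup Γ) (hL : ∀ s, D.L ≤ H' s)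
    (hH : ∀ s, H s ≤ H' s) (hfix : ∀ s, ∀ h ∈ H' s, h • c = c)
    (hθ : ∀ s, ∀ h ∈ H' s, D.θ h ∈ H s)
    (hX : IsSated (FunctorialSigma.join fun s => FunctorialSigma.ofSubgroup (H' s)) X) :
    RelIndep X.μ (X.invariantSigma D.L) (⨆ s, X.invariantSigma (H s))
      (⨆ s, X.invariantSigma (H' s)) := by
  refine RelIndep.of_joining (Ω' := (D.space X).carrier)
    (n := ⨆ s, (D.space X).invariantSigma (H' s)) (μ' := (D.space X).μ)
    (p := Prod.fst) (q := fun z => z.2 c) (D.measurePreserving_fst X)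
    (D.measurePreserving_eval X hc) (X.invariantSigma_le D.L)
    (iSup_le fun s => X.invariantSigma_le (H s)) (iSup_le fun s => X.invariantSigma_anti (hL s))
    (iSup_mono fun s => X.invariantSigma_anti (hH s))
    (hX (D.space X) Prod.fst (D.isExtension_fst X)) ?_
    fun f g hfm hf hgm hg => D.integral_mul_eval X hc hfm hf hgm hg
  rw [MeasurableSpace.comap_iSup]
  exact iSup_mono fun s => D.comap_eval_le X hc (hfix s) (hθ s)

/-- Relative independence in sated spaces, obtained by coinduction along `Γ` itself. -/
theorem relIndep_of_isSated [Countable Γ] (X : GSpace.{u} Γ) (L : Subgroup Γ) (ρ θ : Γ →* Γ)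
    (normalizes : ∀ g, ∀ l ∈ L, ρ g * l * (ρ g)⁻¹ ∈ L) (lifts : ∀ g, (ρ g)⁻¹ * θ g ∈ L)
    {κ : Type} (H H' : κ → Subgroup Γ) (hL : ∀ s, L ≤ H' s)
    (hH : ∀ s, H s ≤ H' s) (hρ : ∀ s, ∀ h ∈ H' s, ρ h = h) (hθ : ∀ s, ∀ h ∈ H' s, θ h ∈ H s)
    (hX : IsSated (FunctorialSigma.join fun s => FunctorialSigma.ofSubgroup (H' s)) X) :
    RelIndep X.μ (X.invariantSigma L) (⨆ s, X.invariantSigma (H s))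
      (⨆ s, X.invariantSigma (H' s)) := by
  -- The index set has to live in the universe of the spaces; a countable group has a copy there.
  have : Small.{u} Γ := Countable.toSmall Γ
  let e : Γ ≃ Shrink.{u} Γ := equivShrink Γ
  have : Countable (Shrink.{u} Γ) := e.symm.injective.countable
  let D : CoindData.{u} Γ :=
    { L := L
      ρ := ρ
      θ := θ
      ι := Shrink.{u} Γ
      action :=
        { smul := fun g c => e (g * e.symm c * (ρ g)⁻¹)
          one_smul := fun c => by
            change e (1 * e.symm c * (ρ 1)⁻¹) = c
            simp
          mul_smul := fun g h c => by
            change e (g * h * e.symm c * (ρ (g * h))⁻¹) =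
              e (g * e.symm (e (h * e.symm c * (ρ h)⁻¹)) * (ρ g)⁻¹)
            simp [mul_assoc] }
      σ := e.symm
      normalizes := normalizes
      lifts := lifts
      equivariant := fun g c => e.symm_apply_apply _ }
  -- Under the twisted action `c ↦ g c (ρ g)⁻¹`, the stabilizer of `1` is exactly the set where `ρ g
  -- = g`.
  refine D.relIndep_of_isSated X (c := e 1) (e.symm_apply_apply 1) H H' hL hH
    (fun s h hh => ?_) hθ hX
  change e (h * e.symm (e 1) * (ρ h)⁻¹) = e 1
  simp [hρ s h hh]

end Sated

/-! ### The subgroups `L_e` and part (A) -/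

section SubgroupL

variable {G : Type v} [Group G] {d : ℕ}

/-- This form avoids consecutive elements of `e`: an entry can change only on passing a point of
`e`, and is trivial up to the first point and after the last. Monotonicity in `e` becomes immediate.
-/
theorem mem_subgroupL_iff {e : Finset (Fin d)} {g : Fin d → G} :
    g ∈ subgroupL G e ↔
      (∀ k l, k ≤ l → (∀ x ∈ e, ¬ (k ≤ x ∧ x < l)) → g k = g l) ∧
      (∀ k, (∀ x ∈ e, k ≤ x) → g k = 1) ∧ (∀ k, (∀ x ∈ e, x < k) → g k = 1) := by
  constructor
  · rintro ⟨h₁, h₂⟩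
    have h₃ : ∀ k, (∀ x ∈ e, k ≤ x) → g k = 1 := fun k hk => h₂ k (by
      rintro ⟨a, ha, b, -, hab⟩
      exact absurd (Finset.mem_Ioc.1 hab).1 (not_lt.2 (hk a ha)))
    have h₄ : ∀ k, (∀ x ∈ e, x < k) → g k = 1 := fun k hk => h₂ k (by
      rintro ⟨a, -, b, hb, hab⟩
      exact absurd (Finset.mem_Ioc.1 hab).2 (not_le.2 (hk b hb)))
    refine ⟨fun k l hkl hno => ?_, h₃, h₄⟩
    by_cases ha : ∀ x ∈ e, k ≤ x
    · rw [h₃ k ha, h₃ l fun x hx => not_lt.1 fun hlt => hno x hx ⟨ha x hx, hlt⟩]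
    by_cases hb : ∀ x ∈ e, x < k
    · rw [h₄ k hb, h₄ l fun x hx => (hb x hx).trans_le hkl]
    push Not at ha hb
    have hA : (e.filter (· < k)).Nonempty := by
      obtain ⟨a, ha, hak⟩ := ha
      exact ⟨a, Finset.mem_filter.2 ⟨ha, hak⟩⟩
    have hB : (e.filter (k ≤ ·)).Nonempty := by
      obtain ⟨b, hb, hbk⟩ := hb
      exact ⟨b, Finset.mem_filter.2 ⟨hb, hbk⟩⟩
    obtain ⟨hae, hak⟩ := Finset.mem_filter.1 (Finset.max'_mem _ hA)
    obtain ⟨hbe, hkb⟩ := Finset.mem_filter.1 (Finset.min'_mem _ hB)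
    have hlb := not_lt.1 fun hlt => hno _ hbe ⟨hkb, hlt⟩
    refine h₁ _ hae _ hbe (hak.trans_le hkb) (fun c hc hacb => ?_) k
      (Finset.mem_Ioc.2 ⟨hak, hkb⟩) l (Finset.mem_Ioc.2 ⟨hak.trans_le hkl, hlb⟩)
    rcases lt_or_ge c k with hck | hkc
    · exact absurd hacb.1 (not_lt.2 (Finset.le_max' _ c (Finset.mem_filter.2 ⟨hc, hck⟩)))
    · exact absurd hacb.2 (not_lt.2 (Finset.min'_le _ c (Finset.mem_filter.2 ⟨hc, hkc⟩)))
  · rintro ⟨h₁, h₂, h₃⟩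
    refine ⟨fun a _ b _ _ hc k hk l hl => ?_, fun k hk => ?_⟩
    · rw [Finset.mem_Ioc] at hk hl
      rcases le_total k l with hkl | hkl
      · exact h₁ k l hkl fun x hx hkx => hc x hx ⟨hk.1.trans_le hkx.1, hkx.2.trans_le hl.2⟩
      · exact (h₁ l k hkl fun x hx hkx => hc x hx ⟨hl.1.trans_le hkx.1, hkx.2.trans_le hk.2⟩).symm
    · by_cases ha : ∀ x ∈ e, k ≤ x
      · exact h₂ k ha
      · push Not at ha
        obtain ⟨a, hae, hak⟩ := ha
        exact h₃ k fun b hb => not_le.1 fun hkb => hk ⟨a, hae, b, hb, Finset.mem_Ioc.2 ⟨hak, hkb⟩⟩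

theorem subgroupL_mono {e e' : Finset (Fin d)} (h : e ⊆ e') : subgroupL G e ≤ subgroupL G e' := by
  intro g hg
  rw [mem_subgroupL_iff] at hg ⊢
  exact ⟨fun k l hkl hno => hg.1 k l hkl fun x hx => hno x (h hx),
    fun k hk => hg.2.1 k fun x hx => hk x (h hx), fun k hk => hg.2.2 k fun x hx => hk x (h hx)⟩

theorem mem_subgroupL_pair {i j : Fin d} (hij : i < j) {g : Fin d → G} :
    g ∈ subgroupL G {i, j} ↔
      (∀ k ∈ Finset.Ioc i j, g k = g j) ∧ ∀ k ∉ Finset.Ioc i j, g k = 1 := by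
  rw [mem_subgroupL_iff]
  simp only [Finset.mem_insert, Finset.mem_singleton, forall_eq_or_imp, forall_eq, Finset.mem_Ioc]
  constructor
  · rintro ⟨h₁, h₂, h₃⟩
    refine ⟨fun k hk => h₁ k j hk.2 ⟨fun h => absurd h.1 (not_le.2 hk.1),
      fun h => absurd h.2 (lt_irrefl j)⟩, fun k hk => ?_⟩
    rcases le_or_gt k i with hki | hki
    · exact h₂ k ⟨hki, hki.trans hij.le⟩
    · have hjk : j < k := not_le.1 fun h => hk ⟨hki, h⟩
      exact h₃ k ⟨hki, hjk⟩
  · rintro ⟨h₁, h₂⟩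
    refine ⟨fun k l hkl hno => ?_, fun k hk => h₂ k fun h => absurd h.1 (not_lt.2 hk.1),
      fun k hk => h₂ k fun h => absurd h.2 (not_le.2 hk.2)⟩
    have h : i < k ∧ k ≤ j ↔ i < l ∧ l ≤ j := by grind
    by_cases hk : i < k ∧ k ≤ j
    · rw [h₁ k hk, h₁ l (h.1 hk)]
    · rw [h₂ k hk, h₂ l (mt h.2 hk)]

/-- The endomorphism of `G^d` that replaces the entries in `(i; j]` of a tuple `h` by `v h`. -/
def fillHom (i j : Fin d) (v : (Fin d → G) →* G) : (Fin d → G) →* (Fin d → G) where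
  toFun h k := if k ∈ Finset.Ioc i j then v h else h k
  map_one' := by
    ext k
    simp
  map_mul' g h := by
    ext k
    by_cases hk : k ∈ Finset.Ioc i j <;> simp only [hk, if_true, if_false, map_mul, Pi.mul_apply]

theorem fillHom_of_mem {i j : Fin d} (v : (Fin d → G) →* G) (h : Fin d → G) {k : Fin d}
    (hk : k ∈ Finset.Ioc i j) : fillHom i j v h k = v h := if_pos hk

theorem fillHom_of_notMem {i j : Fin d} (v : (Fin d → G) →* G) (h : Fin d → G) {k : Fin d}
    (hk : k ∉ Finset.Ioc i j) : fillHom i j v h k = h k := if_neg hk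

/-- Evaluation at the index following `j`, and `1` if there is none. -/
def evalSucc (G : Type v) [Group G] {d : ℕ} (j : Fin d) : (Fin d → G) →* G :=
  if h : j.1 + 1 < d then Pi.evalMonoidHom (fun _ => G) ⟨j.1 + 1, h⟩ else 1

/-- Dropping `j` as a breakpoint requires the entries just before and just after it to agree;
overwriting `(i;j]` by the following entry achieves this. The jump created after `i` is allowed
since `i ∈ e`. -/
theorem fillHom_evalSucc_mem {i j : Fin d} (hij : i < j) {e : Finset (Fin d)}
    (hie : i ∈ e) {h : Fin d → G} (hh : h ∈ subgroupL G (e ∪ {j})) :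
    fillHom i j (evalSucc G j) h ∈ subgroupL G e := by
  rw [mem_subgroupL_iff] at hh ⊢
  simp only [Finset.mem_union, Finset.mem_singleton] at hh
  obtain ⟨h₁, h₂, h₃⟩ := hh
  have hs₁ : ∀ l, j < l → (∀ x ∈ e, ¬ (j < x ∧ x < l)) → evalSucc G j h = h l := by
    intro l hjl hx
    have hd : j.1 + 1 < d := lt_of_le_of_lt (Nat.succ_le_of_lt hjl) l.2
    rw [evalSucc, dif_pos hd]
    refine h₁ ⟨j.1 + 1, hd⟩ l (Nat.succ_le_of_lt hjl) ?_
    rintro x hxe ⟨hjx, hxl⟩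
    have hjx' : j < x := Nat.lt_of_succ_le hjx
    rcases hxe with hxe | rfl
    · exact hx x hxe ⟨hjx', hxl⟩
    · exact lt_irrefl _ hjx'
  -- With no point of `e` after `j`, the tuple is trivial there. The default `1` of `evalSucc`
  -- continues this when `j` is the last index.
  have hs₂ : (∀ x ∈ e, x ≤ j) → evalSucc G j h = 1 := by
    intro hx
    by_cases hd : j.1 + 1 < d
    · rw [evalSucc, dif_pos hd]
      refine h₃ ⟨j.1 + 1, hd⟩ ?_
      rintro x (hxe | rfl)
      · exact Nat.lt_succ_of_le (hx x hxe)
      · exact Nat.lt_succ_self _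
    · rw [evalSucc, dif_neg hd]
      rfl
  refine ⟨fun k l hkl hkx => ?_, fun k hk => ?_, fun k hk => ?_⟩
  · by_cases hk : k ∈ Finset.Ioc i j
    · rw [fillHom_of_mem _ _ hk]
      rw [Finset.mem_Ioc] at hk
      by_cases hl : l ∈ Finset.Ioc i j
      · rw [fillHom_of_mem _ _ hl]
      · rw [fillHom_of_notMem _ _ hl]
        rw [Finset.mem_Ioc] at hl
        have hjl : j < l := not_le.1 fun h => hl ⟨hk.1.trans_le hkl, h⟩
        exact hs₁ l hjl fun x hx hjx => hkx x hx ⟨hk.2.trans hjx.1.le, hjx.2⟩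
    · rw [fillHom_of_notMem _ _ hk]
      rw [Finset.mem_Ioc] at hk
      have hl : l ∉ Finset.Ioc i j := by
        rw [Finset.mem_Ioc]
        intro hl
        rcases le_or_gt k i with hki | hki
        · exact hkx i hie ⟨hki, hl.1⟩
        · exact hk ⟨hki, hkl.trans hl.2⟩
      rw [fillHom_of_notMem _ _ hl]
      refine h₁ k l hkl ?_
      rintro x (hxe | rfl) hx
      · exact hkx x hxe hx
      · rcases le_or_gt k i with hki | hki
        · exact hkx i hie ⟨hki, hij.trans hx.2⟩
        · exact hk ⟨hki, hx.1⟩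
  · have hki := hk i hie
    rw [fillHom_of_notMem _ _ (by rw [Finset.mem_Ioc]; exact fun h => absurd h.1 (not_lt.2 hki))]
    refine h₂ k ?_
    rintro x (hxe | rfl)
    · exact hk x hxe
    · exact hki.trans hij.le
  · have hik := hk i hie
    by_cases hkm : k ∈ Finset.Ioc i j
    · rw [fillHom_of_mem _ _ hkm]
      exact hs₂ fun x hx => (hk x hx).le.trans (Finset.mem_Ioc.1 hkm).2
    · rw [fillHom_of_notMem _ _ hkm]
      rw [Finset.mem_Ioc] at hkm
      refine h₃ k ?_
      rintro x (hxe | rfl)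
      · exact hk x hxe
      · exact not_le.1 fun h => hkm ⟨hik, h⟩

/-- The mirror image: `(i;j]` is merged with the block ending at `i`, and the jump after `j` is
allowed since `j ∈ e`. If `i` precedes all of `e`, its entry is already `1`, so no default is
needed. -/
theorem fillHom_eval_mem {i j : Fin d} (hij : i < j) {e : Finset (Fin d)}
    (hje : j ∈ e) {h : Fin d → G} (hh : h ∈ subgroupL G (e ∪ {i})) :
    fillHom i j (Pi.evalMonoidHom (fun _ => G) i) h ∈ subgroupL G e := by
  rw [mem_subgroupL_iff] at hh ⊢
  simp only [Finset.mem_union, Finset.mem_singleton] at hh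
  obtain ⟨h₁, h₂, h₃⟩ := hh
  refine ⟨fun k l hkl hkx => ?_, fun k hk => ?_, fun k hk => ?_⟩
  · by_cases hl : l ∈ Finset.Ioc i j
    · rw [fillHom_of_mem _ _ hl]
      rw [Finset.mem_Ioc] at hl
      by_cases hk : k ∈ Finset.Ioc i j
      · rw [fillHom_of_mem _ _ hk]
      · rw [fillHom_of_notMem _ _ hk]
        rw [Finset.mem_Ioc] at hk
        have hki : k ≤ i := not_lt.1 fun h => hk ⟨h, hkl.trans hl.2⟩
        refine h₁ k i hki ?_
        rintro x (hxe | rfl) hx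
        · exact hkx x hxe ⟨hx.1, hx.2.trans hl.1⟩
        · exact lt_irrefl _ hx.2
    · rw [fillHom_of_notMem _ _ hl]
      rw [Finset.mem_Ioc] at hl
      have hk : k ∉ Finset.Ioc i j := by
        rw [Finset.mem_Ioc]
        intro hk
        rcases le_or_gt l j with hlj | hlj
        · exact hl ⟨hk.1.trans_le hkl, hlj⟩
        · exact hkx j hje ⟨hk.2, hlj⟩
      rw [fillHom_of_notMem _ _ hk]
      refine h₁ k l hkl ?_
      rintro x (hxe | rfl) hx
      · exact hkx x hxe hx
      · rcases le_or_gt l j with hlj | hlj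
        · exact hl ⟨hx.2, hlj⟩
        · exact hkx j hje ⟨hx.1.trans hij.le, hlj⟩
  · have hkj := hk j hje
    by_cases hkm : k ∈ Finset.Ioc i j
    · rw [fillHom_of_mem _ _ hkm]
      refine h₂ i ?_
      rintro x (hxe | rfl)
      · exact (Finset.mem_Ioc.1 hkm).1.le.trans (hk x hxe)
      · exact le_rfl
    · rw [fillHom_of_notMem _ _ hkm]
      rw [Finset.mem_Ioc] at hkm
      refine h₂ k ?_
      rintro x (hxe | rfl)
      · exact hk x hxe
      · exact not_lt.1 fun h => hkm ⟨h, hkj⟩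
  · have hjk := hk j hje
    rw [fillHom_of_notMem _ _ (by rw [Finset.mem_Ioc]; exact fun h => absurd h.2 (not_le.2 hjk))]
    refine h₃ k ?_
    rintro x (hxe | rfl)
    · exact hk x hxe
    · exact hij.trans hjk

theorem fillHom_eval_eq {i j : Fin d} {e : Finset (Fin d)}
    (he : ∀ x ∈ e, ¬ (i < x ∧ x < j)) {h : Fin d → G} (hh : h ∈ subgroupL G e) :
    fillHom i j (Pi.evalMonoidHom (fun _ => G) j) h = h := by
  ext k
  by_cases hk : k ∈ Finset.Ioc i j
  · rw [fillHom_of_mem _ _ hk]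
    rw [Finset.mem_Ioc] at hk
    exact ((mem_subgroupL_iff.1 hh).1 k j hk.2
      fun x hx hkx => he x hx ⟨hk.1.trans_le hkx.1, hkx.2⟩).symm
  · rw [fillHom_of_notMem _ _ hk]

theorem relIndep_Phi_pair [Countable G] (X : GSpace.{u} (Fin d → G)) {i j : Fin d} (hij : i < j)
    (v : (Fin d → G) →* G) {r : ℕ} (e e' : Fin r → Finset (Fin d)) (hij' : ∀ s, {i, j} ⊆ e' s)
    (hee' : ∀ s, e s ⊆ e' s) (he' : ∀ s, ∀ x ∈ e' s, ¬ (i < x ∧ x < j))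
    (hv : ∀ s, ∀ h ∈ subgroupL G (e' s), fillHom i j v h ∈ subgroupL G (e s))
    (hX : IsSated (joinPhi G e') X) :
    RelIndep X.μ ((Phi G {i, j}).toFun X) ((joinPhi G e).toFun X) ((joinPhi G e').toFun X) := by
  refine relIndep_of_isSated X (subgroupL G {i, j})
    (fillHom i j (Pi.evalMonoidHom (fun _ => G) j)) (fillHom i j v) (fun g l hl => ?_)
    (fun g => ?_) (fun s => subgroupL G (e s)) (fun s => subgroupL G (e' s))
    (fun s => subgroupL_mono (hij' s)) (fun s => subgroupL_mono (hee' s))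
    (fun s h hh => fillHom_eval_eq (he' s) hh) hv hX
  · rw [mem_subgroupL_pair hij] at hl ⊢
    refine ⟨fun k hk => ?_, fun k hk => ?_⟩
    · have hj : j ∈ Finset.Ioc i j := Finset.right_mem_Ioc.2 hij
      simp only [Pi.mul_apply, Pi.inv_apply]
      rw [hl.1 k hk, fillHom_of_mem _ _ hk, fillHom_of_mem _ _ hj]
    · simp only [Pi.mul_apply, Pi.inv_apply]
      rw [hl.2 k hk, mul_one, mul_inv_cancel]
  · rw [mem_subgroupL_pair hij]
    refine ⟨fun k hk => ?_, fun k hk => ?_⟩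
    · have hj : j ∈ Finset.Ioc i j := Finset.right_mem_Ioc.2 hij
      simp only [Pi.mul_apply, Pi.inv_apply, fillHom_of_mem _ _ hk, fillHom_of_mem _ _ hj]
    · simp only [Pi.mul_apply, Pi.inv_apply, fillHom_of_notMem _ _ hk, inv_mul_cancel]

theorem relIndep_Phi_pair_left [Countable G] (X : GSpace.{u} (Fin d → G)) {i j : Fin d}
    (hij : i < j) {r : ℕ} (e : Fin r → Finset (Fin d)) (he : ∀ s, e s ∩ Finset.Ico i j = {i})
    (hX : IsSated (joinPhi G fun s => e s ∪ {j}) X) :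
    RelIndep X.μ ((Phi G {i, j}).toFun X) ((joinPhi G e).toFun X)
      ((joinPhi G fun s => e s ∪ {j}).toFun X) := by
  have hi : ∀ s, i ∈ e s := fun s =>
    (Finset.mem_inter.1 (he s ▸ Finset.mem_singleton_self i)).1
  refine relIndep_Phi_pair X hij (evalSucc G j) e _ (fun s => ?_)
    (fun s => Finset.subset_union_left) (fun s x hx hijx => ?_)
    (fun s h hh => fillHom_evalSucc_mem hij (hi s) hh) hX
  · simp [Finset.insert_subset_iff, hi s]
  · rcases Finset.mem_union.1 hx with hx | hx
    · exact hijx.1.ne' (Finset.mem_singleton.1 (he s ▸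
        Finset.mem_inter.2 ⟨hx, Finset.mem_Ico.2 ⟨hijx.1.le, hijx.2⟩⟩))
    · exact hijx.2.ne (Finset.mem_singleton.1 hx)

theorem relIndep_Phi_pair_right [Countable G] (X : GSpace.{u} (Fin d → G)) {i j : Fin d}
    (hij : i < j) {r : ℕ} (e : Fin r → Finset (Fin d)) (he : ∀ s, e s ∩ Finset.Ioc i j = {j})
    (hX : IsSated (joinPhi G fun s => e s ∪ {i}) X) :
    RelIndep X.μ ((Phi G {i, j}).toFun X) ((joinPhi G e).toFun X)
      ((joinPhi G fun s => e s ∪ {i}).toFun X) := by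
  have hj : ∀ s, j ∈ e s := fun s =>
    (Finset.mem_inter.1 (he s ▸ Finset.mem_singleton_self j)).1
  refine relIndep_Phi_pair X hij (Pi.evalMonoidHom (fun _ => G) i) e _ (fun s => ?_)
    (fun s => Finset.subset_union_left) (fun s x hx hijx => ?_)
    (fun s h hh => fillHom_eval_mem hij (hj s) hh) hX
  · simp [Finset.insert_subset_iff, hj s]
  · rcases Finset.mem_union.1 hx with hx | hx
    · exact hijx.2.ne (Finset.mem_singleton.1 (he s ▸
        Finset.mem_inter.2 ⟨hx, Finset.mem_Ioc.2 ⟨hijx.1, hijx.2.le⟩⟩))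
    · exact hijx.1.ne' (Finset.mem_singleton.1 hx)

end SubgroupL

/-! ### Conditional independence for antitone families of σ-algebras -/

section LatticeIndependence

variable {Ω : Type u} {d : ℕ}

/-- The join of the `σ`-algebras attached to the members of `𝒜`. -/
@[reducible]
def joinOver (Φ : Finset (Fin d) → MeasurableSpace Ω) (𝒜 : Finset (Finset (Fin d))) :
    MeasurableSpace Ω :=
  ⨆ e ∈ 𝒜, Φ e

variable {Φ : Finset (Fin d) → MeasurableSpace Ω}

theorem le_joinOver {𝒜 : Finset (Finset (Fin d))} {e : Finset (Fin d)} (he : e ∈ 𝒜) :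
    Φ e ≤ joinOver Φ 𝒜 :=
  le_iSup₂_of_le e he le_rfl

theorem joinOver_le_iff {𝒜 : Finset (Finset (Fin d))} {m : MeasurableSpace Ω} :
    joinOver Φ 𝒜 ≤ m ↔ ∀ e ∈ 𝒜, Φ e ≤ m :=
  iSup₂_le_iff

theorem joinOver_empty : joinOver Φ ∅ = ⊥ := by simp [joinOver]

theorem joinOver_singleton (e : Finset (Fin d)) : joinOver Φ {e} = Φ e := by simp [joinOver]

theorem joinOver_union (𝒜 ℬ : Finset (Finset (Fin d))) :
    joinOver Φ (𝒜 ∪ ℬ) = joinOver Φ 𝒜 ⊔ joinOver Φ ℬ :=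
  Finset.iSup_union

theorem joinOver_le (hΦ : Antitone Φ) {𝒜 ℬ : Finset (Finset (Fin d))}
    (h : ∀ e ∈ 𝒜, ∃ f ∈ ℬ, f ⊆ e) : joinOver Φ 𝒜 ≤ joinOver Φ ℬ :=
  joinOver_le_iff.2 fun e he => by
    obtain ⟨f, hf, hfe⟩ := h e he
    exact (hΦ hfe).trans (le_joinOver hf)

theorem joinOver_congr (hΦ : Antitone Φ) {𝒜 ℬ : Finset (Finset (Fin d))}
    (h : ∀ e ∈ 𝒜, ∃ f ∈ ℬ, f ⊆ e) (h' : ∀ e ∈ ℬ, ∃ f ∈ 𝒜, f ⊆ e) :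
    joinOver Φ 𝒜 = joinOver Φ ℬ :=
  le_antisymm (joinOver_le hΦ h) (joinOver_le hΦ h')

open scoped FinsetFamily

variable [mΩ : MeasurableSpace Ω] {μ : Measure Ω} [IsProbabilityMeasure μ]

/-- One member of `ℬ` is added at a time. Weak union brings the hypothesis for the new `f` against
`𝒜 ∪ ℬ` to the base needed for contraction; by antitonicity, the sets `f ∪ b` are absorbed by `b`.
-/
theorem cindep_joinOver_sups (hΦ : Antitone Φ) (hle : ∀ e, Φ e ≤ mΩ)
    {𝒰 : Finset (Finset (Fin d))}
    (h : ∀ e₀ ∈ 𝒰, ∀ 𝒜 ⊆ 𝒰, CIndep μ (Φ e₀) (joinOver Φ 𝒜) (joinOver Φ (𝒜.image (e₀ ∪ ·))))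
    {𝒜 ℬ : Finset (Finset (Fin d))} (h𝒜 : 𝒜 ⊆ 𝒰) (hℬ : ℬ ⊆ 𝒰) :
    CIndep μ (joinOver Φ 𝒜) (joinOver Φ ℬ) (joinOver Φ (𝒜 ⊻ ℬ)) := by
  induction ℬ using Finset.induction_on with
  | empty =>
    rw [Finset.sups_empty, joinOver_empty]
    exact CIndep.refl_right (joinOver_le_iff.2 fun e _ => hle e) bot_le
  | insert f ℬ _ ih =>
    have hf : f ∈ 𝒰 := hℬ (Finset.mem_insert_self f ℬ)
    have hℬ' : ℬ ⊆ 𝒰 := (Finset.subset_insert f ℬ).trans hℬ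
    have h₁ : CIndep μ (joinOver Φ 𝒜) (joinOver Φ ℬ)
        (joinOver Φ (𝒜 ⊻ ℬ) ⊔ joinOver Φ (𝒜.image (f ∪ ·))) :=
      (ih hℬ').weak_union_left (joinOver_le hΦ fun e he => by
        obtain ⟨a, ha, rfl⟩ := Finset.mem_image.1 he
        exact ⟨a, ha, Finset.subset_union_right⟩)
    have h₂ := ((h f hf (𝒜 ∪ ℬ) (Finset.union_subset h𝒜 hℬ')).weak_union
      (n := joinOver Φ ℬ) (joinOver_union 𝒜 ℬ ▸ le_sup_right)).mono_right
      (n := joinOver Φ 𝒜) (joinOver_union 𝒜 ℬ ▸ le_sup_left)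
    have e₁ : joinOver Φ ((𝒜 ∪ ℬ).image (f ∪ ·)) ⊔ joinOver Φ ℬ =
        joinOver Φ ℬ ⊔ (joinOver Φ (𝒜 ⊻ ℬ) ⊔ joinOver Φ (𝒜.image (f ∪ ·))) := by
      simp only [← joinOver_union]
      refine joinOver_congr hΦ (fun e he => ?_) fun e he => ?_
      · simp only [Finset.mem_union, Finset.mem_image] at he ⊢
        rcases he with ⟨a, ha | ha, rfl⟩ | he
        · exact ⟨f ∪ a, Or.inr (Or.inr ⟨a, ha, rfl⟩), subset_rfl⟩
        · exact ⟨a, Or.inl ha, Finset.subset_union_right⟩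
        · exact ⟨e, Or.inl he, subset_rfl⟩
      · simp only [Finset.mem_union, Finset.mem_image, Finset.mem_sups] at he ⊢
        rcases he with he | ⟨a, ha, b, hb, rfl⟩ | ⟨a, ha, rfl⟩
        · exact ⟨e, Or.inr he, subset_rfl⟩
        · exact ⟨b, Or.inr hb, le_sup_right⟩
        · exact ⟨f ∪ a, Or.inl ⟨a, Or.inl ha, rfl⟩, subset_rfl⟩
    rw [e₁] at h₂
    have h₃ := h₁.contraction h₂.symm
    have e₂ : joinOver Φ (𝒜 ⊻ ℬ) ⊔ joinOver Φ (𝒜.image (f ∪ ·)) =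
        joinOver Φ (𝒜 ⊻ insert f ℬ) := by
      rw [← joinOver_union]
      congr 1
      ext e
      simp only [Finset.mem_union, Finset.mem_image, Finset.mem_sups, Finset.mem_insert,
        Finset.sup_eq_union, exists_eq_or_imp]
      simp only [or_comm, Finset.union_comm f, and_or_left, exists_or]
    rw [e₂] at h₃
    refine h₃.mono_right (joinOver_le_iff.2 fun e he => ?_)
    rcases Finset.mem_insert.1 he with rfl | he
    · exact le_sup_right
    · exact (le_joinOver he).trans le_sup_left

/-- The step that enlarges the common core of a family by one point `b`. -/
theorem cindep_joinOver_step (hΦ : Antitone Φ) {E V : Finset (Fin d)} {p b : Fin d}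
    (hp : p ∈ E) (hbV : b ∈ V)
    (hgap : ∀ 𝒯 ⊆ Finset.Icc E (V.erase b),
      CIndep μ (Φ {p, b}) (joinOver Φ 𝒯) (joinOver Φ (𝒯.image (insert b))))
    (hcore : ∀ 𝒜 ⊆ Finset.Icc (insert b E) V, ∀ ℬ ⊆ Finset.Icc (insert b E) V,
      CIndep μ (joinOver Φ 𝒜) (joinOver Φ ℬ) (joinOver Φ (𝒜 ⊻ ℬ)))
    (herase : ∀ e₀ ∈ Finset.Icc E (V.erase b), ∀ 𝒜 ⊆ Finset.Icc E (V.erase b),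
      CIndep μ (Φ e₀) (joinOver Φ 𝒜) (joinOver Φ (𝒜.image (e₀ ∪ ·))))
    {e₀ : Finset (Fin d)} (he₀ : e₀ ∈ Finset.Icc E V) {𝒜 : Finset (Finset (Fin d))}
    (h𝒜 : 𝒜 ⊆ Finset.Icc E V) :
    CIndep μ (Φ e₀) (joinOver Φ 𝒜) (joinOver Φ (𝒜.image (e₀ ∪ ·))) := by
  set S := 𝒜.filter (b ∈ ·) with hS
  set T := 𝒜.filter (b ∉ ·) with hT
  have hcov : ∀ e ∈ 𝒜, e ∈ S ∨ e ∈ T := fun e he => by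
    by_cases hb : b ∈ e
    · exact Or.inl (Finset.mem_filter.2 ⟨he, hb⟩)
    · exact Or.inr (Finset.mem_filter.2 ⟨he, hb⟩)
  have hErase : ∀ e ∈ Finset.Icc E V, b ∉ e → e ∈ Finset.Icc E (V.erase b) := fun e he hb => by
    rw [Finset.mem_Icc] at he ⊢
    exact ⟨he.1, Finset.subset_erase.2 ⟨he.2, hb⟩⟩
  have hInsert : ∀ e ∈ Finset.Icc E V, insert b e ∈ Finset.Icc (insert b E) V := fun e he => by
    rw [Finset.mem_Icc] at he ⊢
    exact ⟨Finset.insert_subset_insert b he.1, Finset.insert_subset hbV he.2⟩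
  have hInsert' : ∀ e ∈ Finset.Icc E V, b ∈ e → e ∈ Finset.Icc (insert b E) V := fun e he hb => by
    simpa [Finset.insert_eq_of_mem hb] using hInsert e he
  have hpair : ∀ e ∈ Finset.Icc E V, b ∈ e → Φ e ≤ Φ {p, b} := fun e he hb =>
    hΦ (Finset.insert_subset ((Finset.mem_Icc.1 he).1 hp) (Finset.singleton_subset_iff.2 hb))
  have hSA : ∀ e ∈ S, e ∈ Finset.Icc E V ∧ b ∈ e := fun e he =>
    ⟨h𝒜 (Finset.mem_filter.1 he).1, (Finset.mem_filter.1 he).2⟩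
  have hTA : ∀ e ∈ T, e ∈ Finset.Icc E V ∧ b ∉ e := fun e he =>
    ⟨h𝒜 (Finset.mem_filter.1 he).1, (Finset.mem_filter.1 he).2⟩
  have hS𝒜 : ∀ e ∈ S, e ∈ 𝒜 := fun e he => (Finset.mem_filter.1 he).1
  have hT𝒜 : ∀ e ∈ T, e ∈ 𝒜 := fun e he => (Finset.mem_filter.1 he).1
  have hSc : S ⊆ Finset.Icc (insert b E) V := fun e he => hInsert' e (hSA e he).1 (hSA e he).2
  have hTc : T ⊆ Finset.Icc E (V.erase b) := fun e he => hErase e (hTA e he).1 (hTA e he).2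
  have hSp : joinOver Φ S ≤ Φ {p, b} :=
    joinOver_le_iff.2 fun e he => hpair e (hSA e he).1 (hSA e he).2
  -- If `b ∈ e₀`, then `Φ e₀` and the join over `S` both lie below `Φ {p, b}`. The gap hypothesis
  -- separates them from `T` through `insert b` of `T`, the larger core handles the sets containing
  -- `b`, and contraction combines the two.
  by_cases hb : b ∈ e₀
  · have hU : S ∪ T.image (insert b) ⊆ Finset.Icc (insert b E) V :=
      Finset.union_subset hSc (Finset.image_subset_iff.2 fun e he => hInsert e (hTA e he).1)
    have h₁ := ((((hgap T hTc).mono_left (sup_le (hpair e₀ he₀ hb) hSp)).weak_union_left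
      le_sup_right).mono_left (le_sup_left : Φ e₀ ≤ Φ e₀ ⊔ joinOver Φ S))
    have h₂ := hcore {e₀} (Finset.singleton_subset_iff.2 (hInsert' e₀ he₀ hb)) _ hU
    have eΨ : joinOver Φ ({e₀} ⊻ (S ∪ T.image (insert b))) =
        joinOver Φ (𝒜.image (e₀ ∪ ·)) := by
      refine joinOver_congr hΦ (fun e he => ?_) fun e he => ?_
      · simp only [Finset.mem_sups, Finset.mem_singleton, Finset.mem_union, Finset.mem_image,
          exists_eq_left, Finset.sup_eq_union] at he ⊢
        obtain ⟨f, hf | ⟨t, ht, rfl⟩, rfl⟩ := he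
        · exact ⟨_, ⟨f, hS𝒜 f hf, rfl⟩, subset_rfl⟩
        · exact ⟨_, ⟨t, hT𝒜 t ht, rfl⟩, Finset.union_subset_union_right (Finset.subset_insert b t)⟩
      · simp only [Finset.mem_sups, Finset.mem_singleton, Finset.mem_union, Finset.mem_image,
          exists_eq_left, Finset.sup_eq_union] at he ⊢
        obtain ⟨f, hf, rfl⟩ := he
        rcases hcov f hf with hf | hf
        · exact ⟨_, ⟨f, Or.inl hf, rfl⟩, subset_rfl⟩
        · refine ⟨_, ⟨insert b f, Or.inr ⟨f, hf, rfl⟩, rfl⟩, ?_⟩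
          exact Finset.union_subset Finset.subset_union_left
            (Finset.insert_subset (Finset.mem_union_left _ hb) Finset.subset_union_right)
    rw [joinOver_singleton, eΨ] at h₂
    have hΨ : joinOver Φ (𝒜.image (e₀ ∪ ·)) ≤ joinOver Φ (S ∪ T.image (insert b)) := by
      rw [← eΨ]
      refine joinOver_le hΦ fun e he => ?_
      obtain ⟨a, -, f, hf, rfl⟩ := Finset.mem_sups.1 he
      exact ⟨f, hf, le_sup_right⟩
    have h₃ := h₂.contraction (m₃ := joinOver Φ T) (by
      rw [sup_eq_left.2 hΨ, joinOver_union, sup_comm]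
      exact h₁)
    refine h₃.mono_right (joinOver_le_iff.2 fun e he => ?_)
    rcases hcov e he with he | he
    · exact (le_joinOver (Finset.mem_union_left _ he)).trans le_sup_left
    · exact (le_joinOver he).trans le_sup_right
  -- If `b ∉ e₀`, the roles change: `S` lies below `Φ {p, b}` and is separated from `e₀` and `T`
  -- together. Weak union then puts `T` in the base, and the case without `b` supplies the
  -- independence of `e₀` from `T`.
  · set U := (insert e₀ T).image (insert b) with hUdef
    have hU : U ⊆ Finset.Icc (insert b E) V := Finset.image_subset_iff.2 fun e he => by
      rcases Finset.mem_insert.1 he with rfl | he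
      · exact hInsert e he₀
      · exact hInsert e (hTA e he).1
    have he₀' := hErase e₀ he₀ hb
    have h₁ := (hgap (insert e₀ T) (Finset.insert_subset he₀' hTc)).mono_left hSp
    have h₂ := hcore S hSc U hU
    have hSU : joinOver Φ (S ⊻ U) ≤ joinOver Φ U := joinOver_le hΦ fun e he => by
      obtain ⟨a, -, f, hf, rfl⟩ := Finset.mem_sups.1 he
      exact ⟨f, hf, le_sup_right⟩
    have h₃ := h₂.contraction (m₃ := joinOver Φ (insert e₀ T)) (by
      rw [sup_eq_left.2 hSU]
      exact h₁)
    have hTle : joinOver Φ T ≤ joinOver Φ U ⊔ joinOver Φ (insert e₀ T) :=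
      (joinOver_le_iff.2 fun e he => le_joinOver (Finset.mem_insert_of_mem he)).trans le_sup_right
    have h₄ := ((h₃.weak_union hTle).mono_right
      ((le_joinOver (Finset.mem_insert_self e₀ T)).trans le_sup_right)).symm
    have hPle : joinOver Φ (S.image (e₀ ∪ ·)) ≤ Φ e₀ := joinOver_le_iff.2 fun e he => by
      obtain ⟨f, -, rfl⟩ := Finset.mem_image.1 he
      exact hΦ Finset.subset_union_left
    have h₅ := (herase e₀ he₀' T hTc).weak_union_left hPle
    -- Sets `s ∪ insert b t` are absorbed by `t`, and `s ∪ insert b e₀` is `e₀ ∪ s` because `b ∈ s`.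
    have e₁ : joinOver Φ (S ⊻ U) ⊔ joinOver Φ T = joinOver Φ T ⊔
        (joinOver Φ (T.image (e₀ ∪ ·)) ⊔ joinOver Φ (S.image (e₀ ∪ ·))) := by
      simp only [← joinOver_union]
      refine joinOver_congr hΦ (fun e he => ?_) fun e he => ?_
      · simp only [hUdef, Finset.mem_union, Finset.mem_image, Finset.mem_sups,
          Finset.mem_insert, Finset.sup_eq_union] at he ⊢
        rcases he with ⟨s, hs, _, ⟨f, rfl | hf, rfl⟩, rfl⟩ | he
        · exact ⟨f ∪ s, Or.inr (Or.inr ⟨s, hs, rfl⟩), by grind⟩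
        · exact ⟨f, Or.inl hf, by grind⟩
        · exact ⟨e, Or.inl he, subset_rfl⟩
      · simp only [hUdef, Finset.mem_union, Finset.mem_image, Finset.mem_sups,
          Finset.mem_insert, Finset.sup_eq_union] at he ⊢
        rcases he with he | ⟨t, ht, rfl⟩ | ⟨s, hs, rfl⟩
        · exact ⟨e, Or.inr he, subset_rfl⟩
        · exact ⟨t, Or.inr ht, Finset.subset_union_right⟩
        · refine ⟨s ∪ insert b e₀, Or.inl ⟨s, hs, _, ⟨e₀, Or.inl rfl, rfl⟩, rfl⟩, ?_⟩
          have := (hSA s hs).2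
          grind
    rw [e₁] at h₄
    have h₆ := h₅.contraction h₄
    have e₂ : joinOver Φ (T.image (e₀ ∪ ·)) ⊔ joinOver Φ (S.image (e₀ ∪ ·)) =
        joinOver Φ (𝒜.image (e₀ ∪ ·)) := by
      rw [← joinOver_union, ← Finset.image_union]
      congr 2
      ext e
      rw [Finset.mem_union]
      exact ⟨fun h => h.elim (hT𝒜 e) (hS𝒜 e), fun h => (hcov e h).symm⟩
    rw [e₂] at h₆
    refine h₆.mono_right (joinOver_le_iff.2 fun e he => ?_)
    rcases hcov e he with he | he
    · exact (le_joinOver he).trans le_sup_right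
    · exact (le_joinOver he).trans le_sup_left

/-- Each step lowers `|V \ E|` in two ways: adding `b` to the core or deleting it from `V`. As no
point of `V \ E` lies between points of `E`, the nearest point on either side faces an endpoint `p`
of `E` across a gap free of `V`. -/
theorem cindep_joinOver_of_core (hΦ : Antitone Φ) (hle : ∀ e, Φ e ≤ mΩ)
    (hgap : ∀ (p b : Fin d) (𝒯 : Finset (Finset (Fin d))), p ≠ b →
      (∀ e ∈ 𝒯, p ∈ e ∧ b ∉ e ∧ ∀ x ∈ e, ¬ (p < x ∧ x < b) ∧ ¬ (b < x ∧ x < p)) →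
      CIndep μ (Φ {p, b}) (joinOver Φ 𝒯) (joinOver Φ (𝒯.image (insert b)))) (n : ℕ) :
    ∀ E V : Finset (Fin d), E.Nonempty → E ⊆ V → (V \ E).card ≤ n →
      (∀ x ∈ V, x ∉ E → (∀ y ∈ E, x < y) ∨ ∀ y ∈ E, y < x) →
      ∀ e₀ ∈ Finset.Icc E V, ∀ 𝒜 ⊆ Finset.Icc E V,
        CIndep μ (Φ e₀) (joinOver Φ 𝒜) (joinOver Φ (𝒜.image (e₀ ∪ ·))) := by
  induction n with
  | zero =>
    intro E V _ hEV hcard _ e₀ he₀ 𝒜 h𝒜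
    have hVE : V ⊆ E := Finset.sdiff_eq_empty_iff_subset.1 (Finset.card_eq_zero.1 (by omega))
    have e : joinOver Φ (𝒜.image (e₀ ∪ ·)) = joinOver Φ 𝒜 := by
      congr 1
      refine (Finset.image_congr fun a ha => ?_).trans Finset.image_id
      have h₁ := Finset.mem_Icc.1 (h𝒜 ha)
      have h₂ := Finset.mem_Icc.1 he₀
      exact Finset.union_eq_right.2 ((h₂.2.trans hVE).trans h₁.1)
    rw [e]
    exact CIndep.refl_right (hle e₀) (joinOver_le_iff.2 fun e _ => hle e)
  | succ n ih =>
    intro E V hE hEV hcard hcore e₀ he₀ 𝒜 h𝒜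
    by_cases hVE : V ⊆ E
    · exact ih E V hE hEV (by simp [Finset.sdiff_eq_empty_iff_subset.2 hVE]) hcore e₀ he₀ 𝒜 h𝒜
    have step : ∀ p ∈ E, ∀ b ∈ V, b ∉ E →
        (∀ x ∈ V, ¬ (p < x ∧ x < b) ∧ ¬ (b < x ∧ x < p)) →
        (∀ x ∈ V, x ∉ insert b E → (∀ y ∈ insert b E, x < y) ∨ ∀ y ∈ insert b E, y < x) →
        CIndep μ (Φ e₀) (joinOver Φ 𝒜) (joinOver Φ (𝒜.image (e₀ ∪ ·))) := by
      intro p hp b hbV hbE hpb hcore'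
      have hbVE : b ∈ V \ E := Finset.mem_sdiff.2 ⟨hbV, hbE⟩
      have hlt : ((V \ E).erase b).card ≤ n := by
        rw [Finset.card_erase_of_mem hbVE]
        omega
      refine cindep_joinOver_step hΦ hp hbV (fun 𝒯 h𝒯 => ?_) (fun 𝒜' h𝒜' ℬ hℬ => ?_) ?_ he₀ h𝒜
      · refine hgap p b 𝒯 (fun h => hbE (h ▸ hp)) fun e he => ?_
        have h := Finset.mem_Icc.1 (h𝒯 he)
        exact ⟨h.1 hp, fun hb => absurd (h.2 hb) (Finset.notMem_erase b V),
          fun x hx => hpb x (Finset.mem_of_mem_erase (h.2 hx))⟩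
      · refine cindep_joinOver_sups hΦ hle (ih (insert b E) V (Finset.insert_nonempty b E)
          (Finset.insert_subset hbV hEV) ?_ hcore') h𝒜' hℬ
        refine (Finset.card_le_card fun x hx => ?_).trans hlt
        grind
      · refine ih E (V.erase b) hE (Finset.subset_erase.2 ⟨hEV, hbE⟩) ?_
          fun x hx => hcore x (Finset.mem_of_mem_erase hx)
        refine (Finset.card_le_card fun x hx => ?_).trans hlt
        grind
    -- Points to the right are absorbed first, in increasing order with `p = max E`; afterwards
    -- those to the left, in decreasing order with `p = min E`.
    by_cases hgt : (V.filter fun x => ∀ y ∈ E, y < x).Nonempty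
    · obtain ⟨hbV, hbE⟩ := Finset.mem_filter.1 (Finset.min'_mem _ hgt)
      have hmin : ∀ x ∈ V, (∀ y ∈ E, y < x) → Finset.min' _ hgt ≤ x := fun x hx hy =>
        Finset.min'_le _ x (Finset.mem_filter.2 ⟨hx, hy⟩)
      generalize Finset.min' _ hgt = b at hbV hbE hmin
      have hmE := Finset.max'_mem E hE
      have hmax : ∀ y ∈ E, y ≤ E.max' hE := fun y hy => Finset.le_max' E y hy
      generalize E.max' hE = p at hmE hmax
      refine step p hmE b hbV (fun h => lt_irrefl b (hbE b h)) (fun x hx => ⟨?_, ?_⟩)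
        fun x hx hxE => ?_
      · rintro ⟨hpx, hxb⟩
        exact absurd (hmin x hx fun y hy => (hmax y hy).trans_lt hpx) (not_le.2 hxb)
      · rintro ⟨hbx, hxp⟩
        exact lt_asymm (hbx.trans hxp) (hbE p hmE)
      · rw [Finset.mem_insert, not_or] at hxE
        simp only [Finset.mem_insert, forall_eq_or_imp]
        rcases hcore x hx hxE.2 with h | h
        · exact Or.inl ⟨(h p hmE).trans (hbE p hmE), h⟩
        · exact Or.inr ⟨lt_of_le_of_ne (hmin x hx h) (Ne.symm hxE.1), h⟩
    · have hlt : (V.filter fun x => ∀ y ∈ E, x < y).Nonempty := by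
        obtain ⟨x, hxV, hxE⟩ := Finset.not_subset.1 hVE
        rcases hcore x hxV hxE with h | h
        · exact ⟨x, Finset.mem_filter.2 ⟨hxV, h⟩⟩
        · exact absurd ⟨x, Finset.mem_filter.2 ⟨hxV, h⟩⟩ hgt
      obtain ⟨hbV, hbE⟩ := Finset.mem_filter.1 (Finset.max'_mem _ hlt)
      have hmax : ∀ x ∈ V, (∀ y ∈ E, x < y) → x ≤ Finset.max' _ hlt := fun x hx hy =>
        Finset.le_max' _ x (Finset.mem_filter.2 ⟨hx, hy⟩)
      generalize Finset.max' _ hlt = b at hbV hbE hmax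
      have hmE := Finset.min'_mem E hE
      have hmin : ∀ y ∈ E, E.min' hE ≤ y := fun y hy => Finset.min'_le E y hy
      generalize E.min' hE = p at hmE hmin
      refine step p hmE b hbV (fun h => lt_irrefl b (hbE b h)) (fun x hx => ⟨?_, ?_⟩)
        fun x hx hxE => ?_
      · rintro ⟨hpx, hxb⟩
        exact lt_asymm (hpx.trans hxb) (hbE p hmE)
      · rintro ⟨hbx, hxp⟩
        exact absurd (hmax x hx fun y hy => hxp.trans_le (hmin y hy)) (not_le.2 hbx)
      · rw [Finset.mem_insert, not_or] at hxE
        simp only [Finset.mem_insert, forall_eq_or_imp]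
        rcases hcore x hx hxE.2 with h | h
        · exact Or.inl ⟨lt_of_le_of_ne (hmax x hx h) hxE.1, h⟩
        · exact Or.inr ⟨(hbE p hmE).trans (h p hmE), h⟩

end LatticeIndependence

/-! ### Fully sated spaces and part (B) -/

section FullySated

variable {G : Type v} [Group G] {d : ℕ}

theorem antitone_Phi (X : GSpace.{u} (Fin d → G)) :
    Antitone fun e : Finset (Fin d) => (Phi G e).toFun X :=
  fun _ _ h => X.invariantSigma_anti (subgroupL_mono h)

theorem joinPhi_toFun_eq {r : ℕ} (e : Fin r → Finset (Fin d)) (X : GSpace.{u} (Fin d → G)) :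
    (joinPhi G e).toFun X =
      joinOver (fun f => (Phi G f).toFun X) (Finset.univ.image e) := by
  change (⨆ s, (Phi G (e s)).toFun X) = ⨆ f ∈ Finset.univ.image e, (Phi G f).toFun X
  rw [Finset.iSup_finset_image]
  simp

theorem cindep_Phi_pair [Countable G] {X : GSpace.{u} (Fin d → G)} (hX : FullySated X)
    {p b : Fin d} (𝒯 : Finset (Finset (Fin d))) (hpb : p ≠ b)
    (h : ∀ e ∈ 𝒯, p ∈ e ∧ b ∉ e ∧ ∀ x ∈ e, ¬ (p < x ∧ x < b) ∧ ¬ (b < x ∧ x < p)) :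
    CIndep X.μ ((Phi G {p, b}).toFun X) (joinOver (fun f => (Phi G f).toFun X) 𝒯)
      (joinOver (fun f => (Phi G f).toFun X) (𝒯.image (insert b))) := by
  let e : Fin 𝒯.card → Finset (Fin d) := fun s => (𝒯.equivFin.symm s).1
  have he : ∀ s, e s ∈ 𝒯 := fun s => (𝒯.equivFin.symm s).2
  have himage : Finset.univ.image e = 𝒯 := by
    ext f
    simp only [Finset.mem_image, Finset.mem_univ, true_and]
    refine ⟨?_, fun hf => ⟨𝒯.equivFin ⟨f, hf⟩, by simp [e]⟩⟩
    rintro ⟨s, rfl⟩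
    exact he s
  have himage' : Finset.univ.image (fun s => e s ∪ {b}) = 𝒯.image (insert b) := by
    conv_rhs => rw [← himage]
    rw [Finset.image_image]
    exact Finset.image_congr fun s _ => by simp
  -- The induction also meets singletons such as `{p}`. Satedness is invoked only after adding `b`,
  -- when every set contains the pair `{p, b}`.
  have hsat := hX _ (fun s => e s ∪ {b}) fun s => by
    have h₁ : ({p, b} : Finset (Fin d)) ⊆ e s ∪ {b} := by
      simp [Finset.insert_subset_iff, (h _ (he s)).1]
    exact (Finset.card_pair hpb).symm.le.trans (Finset.card_le_card h₁)
  have h𝒯 := joinPhi_toFun_eq e X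
  have h𝒯' := joinPhi_toFun_eq (fun s => e s ∪ {b}) X
  rw [himage] at h𝒯
  rw [himage'] at h𝒯'
  rw [← h𝒯, ← h𝒯']
  rcases lt_or_gt_of_ne hpb with hlt | hlt
  · refine CIndep.of_relIndep (relIndep_Phi_pair_left X hlt e (fun s => ?_) hsat)
    obtain ⟨h₁, h₂, h₃⟩ := h _ (he s)
    ext x
    simp only [Finset.mem_inter, Finset.mem_Ico, Finset.mem_singleton]
    refine ⟨fun hx => ?_, ?_⟩
    · by_contra hne
      exact (h₃ x hx.1).1 ⟨lt_of_le_of_ne hx.2.1 (Ne.symm hne), hx.2.2⟩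
    · rintro rfl
      exact ⟨h₁, le_rfl, hlt⟩
  · rw [Finset.pair_comm]
    refine CIndep.of_relIndep (relIndep_Phi_pair_right X hlt e (fun s => ?_) hsat)
    obtain ⟨h₁, h₂, h₃⟩ := h _ (he s)
    ext x
    simp only [Finset.mem_inter, Finset.mem_Ioc, Finset.mem_singleton]
    refine ⟨fun hx => ?_, ?_⟩
    · by_contra hne
      exact (h₃ x hx.1).2 ⟨hx.2.1, lt_of_le_of_ne hx.2.2 hne⟩
    · rintro rfl
      exact ⟨h₁, hlt, le_rfl⟩

theorem cindep_joinPhi [Countable G] {X : GSpace.{u} (Fin d → G)} (hX : FullySated X) {r : ℕ}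
    {e₀ : Finset (Fin d)} {e : Fin r → Finset (Fin d)} {c : Fin d} (hc₀ : c ∈ e₀)
    (hc : ∀ s, c ∈ e s) :
    CIndep X.μ ((Phi G e₀).toFun X) ((joinPhi G e).toFun X)
      ((joinPhi G fun s => e₀ ∪ e s).toFun X) := by
  -- The core starts as the single common point `c`, and every other index lies on one side of it.
  have h := cindep_joinOver_of_core (antitone_Phi X) (fun e => (Phi G e).le X)
    (fun p b 𝒯 hpb hT => cindep_Phi_pair hX 𝒯 hpb hT) _ {c} Finset.univ
    (Finset.singleton_nonempty c) (Finset.subset_univ _) le_rfl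
    (fun x _ hx => by simpa using hx) e₀
    (Finset.mem_Icc.2 ⟨Finset.singleton_subset_iff.2 hc₀, Finset.subset_univ _⟩)
    (Finset.univ.image e) (Finset.image_subset_iff.2 fun s _ =>
      Finset.mem_Icc.2 ⟨Finset.singleton_subset_iff.2 (hc s), Finset.subset_univ _⟩)
  rw [Finset.image_image] at h
  rw [joinPhi_toFun_eq, joinPhi_toFun_eq]
  exact h

theorem memLp_top_prod {Ω : Type*} [MeasurableSpace Ω] {μ : Measure Ω} [IsProbabilityMeasure μ]
    {ι : Type*} (s : Finset ι) {f : ι → Ω → ℝ} (hf : ∀ i, MemLp (f i) ⊤ μ) :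
    MemLp (fun x => ∏ i ∈ s, f i x) ⊤ μ := by
  classical
  induction s using Finset.induction_on with
  | empty => simpa using memLp_const (1 : ℝ)
  | insert i s hi ih =>
    simp only [Finset.prod_insert hi]
    exact ih.mul (hf i)

theorem aestronglyMeasurable_prod_of_forall {Ω : Type*} {m m₀ : MeasurableSpace Ω} {μ : Measure Ω}
    {ι : Type*} (s : Finset ι) {f : ι → Ω → ℝ} (hf : ∀ i, AEStronglyMeasurable[m] (f i) μ) :
    AEStronglyMeasurable[m] (fun x => ∏ i ∈ s, f i x) μ := by
  classical
  induction s using Finset.induction_on with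
  | empty => simpa using stronglyMeasurable_const.aestronglyMeasurable
  | insert i s hi ih =>
    simp only [Finset.prod_insert hi]
    exact (hf i).mul ih

end FullySated

theorem proposition5p4 {G : Type v} [Group G] [Countable G] {d : ℕ}
    (X : GSpace.{u} (Fin d → G)) :
    -- relative independence, for satedness with respect to a single join
    (∀ (i j : Fin d), i < j → ∀ (r : ℕ) (e : Fin r → Finset (Fin d)), (∀ s, 2 ≤ (e s).card) →
      ((∀ s, e s ∩ Finset.Ico i j = {i}) →
        IsSated (joinPhi G fun s => e s ∪ {j}) X →
        RelIndep X.μ ((Phi G {i, j}).toFun X) ((joinPhi G e).toFun X)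
          ((joinPhi G fun s => e s ∪ {j}).toFun X)) ∧
      ((∀ s, e s ∩ Finset.Ioc i j = {j}) →
        IsSated (joinPhi G fun s => e s ∪ {i}) X →
        RelIndep X.μ ((Phi G {i, j}).toFun X) ((joinPhi G e).toFun X)
          ((joinPhi G fun s => e s ∪ {i}).toFun X))) ∧
    -- the consequence for fully sated spaces
    (FullySated X → ∀ (r : ℕ) (e₀ : Finset (Fin d)) (e : Fin r → Finset (Fin d)),
      2 ≤ e₀.card → (∀ s, 2 ≤ (e s).card) → (∃ c, c ∈ e₀ ∧ ∀ s, c ∈ e s) →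
      (∀ (g : X.carrier → ℝ) (f : Fin r → X.carrier → ℝ),
        AEStronglyMeasurable[(Phi G e₀).toFun X] g X.μ → MemLp g ⊤ X.μ →
        (∀ s, AEStronglyMeasurable[(Phi G (e s)).toFun X] (f s) X.μ) →
        (∀ s, MemLp (f s) ⊤ X.μ) →
        ∫ x, g x * ∏ s, f s x ∂X.μ =
          ∫ x, ((X.μ)[g | (joinPhi G fun s => e₀ ∪ e s).toFun X]) x * ∏ s, f s x ∂X.μ) ∧
      (∀ g : X.carrier → ℝ,
        AEStronglyMeasurable[(Phi G e₀).toFun X] g X.μ → Integrable g X.μ →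
        (X.μ)[g | (joinPhi G e).toFun X] =ᵐ[X.μ]
          (X.μ)[g | (joinPhi G fun s => e₀ ∪ e s).toFun X])) := by
  refine ⟨fun i j hij r e _ => ⟨relIndep_Phi_pair_left X hij e, relIndep_Phi_pair_right X hij e⟩,
    fun hX r e₀ e _ _ => ?_⟩
  rintro ⟨c, hc₀, hc⟩
  have hci := cindep_joinPhi hX hc₀ hc
  have hbase : (joinPhi G fun s => e₀ ∪ e s).toFun X ≤ (joinPhi G e).toFun X :=
    iSup_mono fun s => antitone_Phi X Finset.subset_union_right
  have hcond : ∀ g : X.carrier → ℝ,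
      AEStronglyMeasurable[(Phi G e₀).toFun X] g X.μ → Integrable g X.μ →
      (X.μ)[g | (joinPhi G e).toFun X] =ᵐ[X.μ]
        (X.μ)[g | (joinPhi G fun s => e₀ ∪ e s).toFun X] :=
    fun g hgm hg => hci.condExp_ae_eq hbase hgm hg
  refine ⟨fun g f hgm hg hfm hf => ?_, hcond⟩
  have hgi := integrable_of_memLp_top hg
  have hF : MemLp (fun x => ∏ s, f s x) ⊤ X.μ := memLp_top_prod Finset.univ hf
  have hFm : AEStronglyMeasurable[(joinPhi G e).toFun X] (fun x => ∏ s, f s x) X.μ :=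
    aestronglyMeasurable_prod_of_forall _ fun s =>
      (hfm s).mono (le_iSup (fun s => (Phi G (e s)).toFun X) s)
  -- The product of the `f s` is measurable for the join, so `g` may be replaced by its projection
  -- there, which equals the projection to `Ψ`.
  have h := integral_mul_condExp_of_aestronglyMeasurable ((joinPhi G e).le X) hFm
    (hgi.mul_of_top_right hF) hgi
  calc ∫ x, g x * ∏ s, f s x ∂X.μ = ∫ x, (∏ s, f s x) * g x ∂X.μ := by simp only [mul_comm]
    _ = _ := h.symm
    _ = _ := integral_congr_ae ((hcond g hgm hgi).mono fun x hx => by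
      simp only [hx, mul_comm])
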